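/- For integers $n\ge 2$ let $$\mathcal I_n(1)=\frac{1}{2\pi i}\int_{\frac32-i\infty}^{\frac32+i\infty}(2\pi)^{-s}\,\Gamma(s)\Gamma(s+1)\Gamma(n-s)\cos\!\left(\frac{\pi s}{2}\right)ds .$$ Let $\lambda(u)=\frac{1}{e^u-1}-\frac1u+\frac12$, with $\lambda(0)=0$ (removable singularity), which is holomorphic near $u=0$, and define complex numbers $P_k$, $k\ge 0$, by the Taylor expansion $$e^{-2\pi i\lambda(u)}=\sum_{k=0}^\infty P_k u^k$$ at $u=0$. For $\nu\in\mathbb C$ and $j\in\mathbb Z_{\ge 0}$ let $$(\nu,j)=\frac{(-1)^j}{j!}\left(\tfrac12-\nu\right)_j\left(\tfrac12+\nu\right)_j$$ be the Hankel symbol, where $(\alpha)_j=\alpha(\alpha+1)\cdots(\alpha+j-1)$ and $(\alpha)_0=1$. For $l\ge 0$ put $$\widetilde C_l=\sum_{\substack{j,k\ge 0\\ j+k=l}}(k+1,j)\,(2\pi i)^kP_k\,2^{-2j}.$$ Then the integral defining $\mathcal I_n(1)$ converges absolutely for every $n\ge 2$, and for each fixed integer $L\ge 1$, as $n\to\infty$,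 $$-\frac{4}{n!}\,\mathcal I_n(1)=2^{9/4}\pi^{3/4}e^{-2\sqrt{\pi n}}\sum_{l=0}^{L}(2\pi)^{-l/2}\,\widetilde C_l\,n^{-\frac l2-\frac34}\sin\!\left(2\sqrt{\pi n}+\frac{\pi l}{4}+\frac{3\pi}{8}\right)+O_L\!\left(n^{-\frac L2-\frac54}e^{-2\sqrt{\pi n}}\right).$$ -/

import Mathlib

noncomputable section

namespace BettinConrey

/-- The integrand `(2πx)^{-s} Γ(s) Γ(s+1) Γ(n-s) cos(πs/2)` of the integral `I_n(x)`. -/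
def integrand (n : ℕ) (x : ℝ) (s : ℂ) : ℂ :=
  ((2 * Real.pi * x : ℝ) : ℂ) ^ (-s) * Complex.Gamma s * Complex.Gamma (s + 1)
    * Complex.Gamma ((n : ℂ) - s) * Complex.cos (Real.pi * s / 2)

/-- `I_n(x) = (1 / 2πi) ∫ integrand(s) ds` over the upward vertical line `Re s = 3/2`,
parametrized by `s = 3/2 + it`, `ds = i dt`. -/
def I (n : ℕ) (x : ℝ) : ℂ :=
  1 / (2 * Real.pi * Complex.I) *
    ∫ t : ℝ, integrand n x (3 / 2 + t * Complex.I) * Complex.I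

/-- `λ(u) = 1/(e^u - 1) - 1/u + 1/2`, with the removable singularity at `u = 0` filled in
by its limit `0`. -/
def lam (u : ℂ) : ℂ :=
  if u = 0 then 0 else 1 / (Complex.exp u - 1) - 1 / u + 1 / 2

/-- `P_k(z)`, the coefficient of `u^k` in the Taylor expansion of `e^{-z λ(u)}` at `u = 0`. -/
def P (k : ℕ) (z : ℂ) : ℂ :=
  iteratedDeriv k (fun u : ℂ => Complex.exp (-z * lam u)) 0 / (k.factorial : ℂ)

/-- The Hankel symbol `(ν, k) = ((-1)^k / k!) (1/2 - ν)_k (1/2 + ν)_k`, where `(α)_k` is the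
rising factorial. -/
def hankel (ν : ℂ) (k : ℕ) : ℂ :=
  (-1) ^ k / (k.factorial : ℂ) * (ascPochhammer ℂ k).eval (1 / 2 - ν)
    * (ascPochhammer ℂ k).eval (1 / 2 + ν)

/-- `C̃_l = ∑_{j + k = l} (k+1, j) (2πi)^k P_k(2πi) 2^{-2j}`. -/
def Ctilde (l : ℕ) : ℂ :=
  ∑ p ∈ Finset.HasAntidiagonal.antidiagonal l,
    hankel ((p.2 : ℂ) + 1) p.1 * (2 * Real.pi * Complex.I) ^ p.2
      * P p.2 (2 * Real.pi * Complex.I) * ((2 : ℂ) ^ (2 * p.1))⁻¹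

end BettinConrey

end

/-!
Why the expansion holds. With `E(z) = ∫₀¹ y ^ (n - 1) e ^ (-z y / (1 - y)) dy`
(`eulerIntegral`), Fubini and the Beta integral give the Mellin transform of `x ↦ E(x z)` as
`Γ(s) Γ(s + 1) Γ(n - s) z ^ (-s) / n!` (`mellin_eulerIntegral`). Mellin inversion on `Re s = 3/2`,
valid for `Re z > 0`, extends by dominated convergence to `z = ±2πi`, since the Gamma factors decay
at least like `e ^ (-π |t|)` up to a power of `t` (`norm_barnesIntegrand_le`), while `z ^ (-s)` grows at most
like `e ^ (π |t| / 2)`. As `cos (π s / 2) (2π) ^ (-s)` is the mean of `(2πi) ^ (-s)` and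
`(-2πi) ^ (-s)`, the integral `I_n(1)` equals `n! Re E(2πi)`.

The substitution `y = e ^ (-u)` and `1 / (e ^ u - 1) = λ(u) + 1 / u - 1 / 2` turn `-E(2πi)` into
`∫ e ^ (-n u - 2πi / u) e ^ (-2πi λ(u)) du` over `u > 0`. The path is rotated to the ray
`arg u = π / 4` through the saddle point `√(2πi / n)`; in the coordinate `log u` this is a shift of
a horizontal line (`eulerIntegral_two_pi_I`). On the ray `e ^ (-2πi λ)` is bounded, so its Taylor
polynomials at `0` approximate it with a remainder `O(u ^ (L + 1))` on the whole ray
(`hasExpansion_exp_lam`), and the `k`-th Taylor term contributes a multiple of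
`2 K_{k + 1}(2 √(2πi n))`.

The Bessel integral `2 K_ν(z) = ∫ e ^ (ν θ - z cosh θ) dθ` becomes a Laplace integral in
`x = 2 cosh θ - 2` whose density is `x ^ (-1/2) T_ν(1 + x / 2) (1 + x / 4) ^ (-1/2)`, with `T_ν` the
Chebyshev polynomial. Its expansion at `0` starts from the binomial series for `ν = 0` and is
carried to all `ν` by the Chebyshev recurrence, to which a recurrence of the Hankel symbols
corresponds (`hankel_add_one_add_hankel_sub_one`, `hasExpansion_besselDensity`). Watson's lemma then gives the
Hankel expansion of `K_ν` (`bessel_expansion`). The terms with `j + k = l` share one power of `n` and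
one phase (`saddle_pow_mul`), and they add up to the multiple `C̃_l`; since `C̃_l` is real
(`conj_Ctilde`), taking twice the real part produces the sine.
-/

namespace MellinBarnes

open MeasureTheory Set Filter Topology Complex
open BettinConrey (hankel lam P Ctilde integrand)

/-! ### Integrals over the half-line, a strip, and the Gamma integral with complex scale -/

theorem integral_Ioi_eq_integral_exp {E : Type*} [NormedAddCommGroup E] [NormedSpace ℝ E]
    (f : ℝ → E) : ∫ x in Ioi (0 : ℝ), f x = ∫ a : ℝ, Real.exp a • f (Real.exp a) := by
  have h := integral_image_eq_integral_abs_deriv_smul (s := univ) (f := Real.exp) (f' := Real.exp)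
    MeasurableSet.univ (fun x _ => (Real.hasDerivAt_exp x).hasDerivWithinAt)
    Real.exp_injective.injOn f
  rw [image_univ, Real.range_exp] at h
  simpa [abs_of_pos (Real.exp_pos _)] using h

theorem integrableOn_Ioi_iff_integrable_exp {E : Type*} [NormedAddCommGroup E] [NormedSpace ℝ E]
    (f : ℝ → E) :
    IntegrableOn f (Ioi (0 : ℝ)) ↔ Integrable (fun a : ℝ => Real.exp a • f (Real.exp a)) := by
  have h := integrableOn_image_iff_integrableOn_abs_deriv_smul (s := univ) (f := Real.exp)
    (f' := Real.exp) MeasurableSet.univ (fun x _ => (Real.hasDerivAt_exp x).hasDerivWithinAt)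
    Real.exp_injective.injOn f
  rw [image_univ, Real.range_exp] at h
  simpa [abs_of_pos (Real.exp_pos _)] using h

theorem integrable_exp_mul_exp_neg_exp {σ κ : ℝ} (hσ : 0 < σ) (hκ : 0 < κ) :
    Integrable (fun a : ℝ => Real.exp (σ * a) * Real.exp (-(κ * Real.exp a))) := by
  have h := (integrableOn_Ioi_iff_integrable_exp _).1
    (integrableOn_rpow_mul_exp_neg_mul_rpow (s := σ - 1) (p := 1) (b := κ) (by linarith)
      zero_lt_one hκ)
  refine h.congr (Eventually.of_forall fun a => ?_)
  simp only [smul_eq_mul, Real.rpow_one]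
  rw [← Real.exp_mul, ← mul_assoc, ← Real.exp_add, neg_mul]
  congr 2; ring

theorem tendsto_exp_mul_exp_neg_exp_atTop (σ : ℝ) {κ : ℝ} (hκ : 0 < κ) :
    Tendsto (fun a : ℝ => Real.exp (σ * a) * Real.exp (-(κ * Real.exp a))) atTop (𝓝 0) := by
  have h := (tendsto_rpow_mul_exp_neg_mul_atTop_nhds_zero σ κ hκ).comp Real.tendsto_exp_atTop
  refine h.congr fun a => ?_
  simp only [Function.comp]
  rw [← Real.exp_mul, neg_mul, mul_comm σ]

theorem tendsto_exp_mul_exp_neg_exp_atBot {σ κ : ℝ} (hσ : 0 < σ) (hκ : 0 < κ) :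
    Tendsto (fun a : ℝ => Real.exp (σ * a) * Real.exp (-(κ * Real.exp a))) atBot (𝓝 0) := by
  have h : Tendsto (fun a : ℝ => Real.exp (σ * a)) atBot (𝓝 0) :=
    Real.tendsto_exp_atBot.comp (tendsto_id.const_mul_atBot hσ)
  refine squeeze_zero (fun a => by positivity) (fun a => ?_) h
  have : Real.exp (-(κ * Real.exp a)) ≤ 1 := Real.exp_le_one_iff.2 (by
    have := Real.exp_pos a; nlinarith)
  nlinarith [Real.exp_pos (σ * a)]

/-- Cauchy's theorem for the strip between `Im w = 0` and `Im w = c` (of either sign): the bound by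
`B (re w)` makes the vertical sides of the rectangles vanish in the limit. -/
theorem integral_strip_shift {f : ℂ → ℂ} {c : ℝ}
    (hf : DifferentiableOn ℂ f {w | w.im ∈ uIcc 0 c}) {B : ℝ → ℝ}
    (hB : ∀ w : ℂ, w.im ∈ uIcc 0 c → ‖f w‖ ≤ B w.re) (hBi : Integrable B)
    (hBt : Tendsto B atTop (𝓝 0)) (hBb : Tendsto B atBot (𝓝 0)) :
    ∫ a : ℝ, f (a + c * I) = ∫ a : ℝ, f a := by
  have hline : ∀ b ∈ uIcc 0 c, Integrable (fun a : ℝ => f (a + b * I)) := by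
    intro b hb
    refine hBi.mono' ?_ (Eventually.of_forall fun a => by
      simpa using hB (a + b * I) (by simpa using hb))
    refine Continuous.aestronglyMeasurable ?_
    exact hf.continuousOn.comp_continuous (by fun_prop) (fun a => by simpa using hb)
  have h0 := hline 0 left_mem_uIcc
  have hc := hline c right_mem_uIcc
  have hvert : ∀ R : ℝ, ‖∫ y in (0 : ℝ)..c, f (R + y * I)‖ ≤ B R * |c| := by
    intro R
    have := intervalIntegral.norm_integral_le_of_norm_le_const (a := (0 : ℝ)) (b := c)
      (f := fun y : ℝ => f (R + y * I)) (C := B R) (fun y hy => by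
        simpa using hB (R + y * I) (by simpa using uIoc_subset_uIcc hy))
    simpa using this
  have hvt : Tendsto (fun R : ℝ => I • ∫ y in (0 : ℝ)..c, f (R + y * I)) atTop (𝓝 0) := by
    have h : Tendsto (fun R : ℝ => ∫ y in (0 : ℝ)..c, f (R + y * I)) atTop (𝓝 0) :=
      squeeze_zero_norm hvert (by simpa using hBt.mul_const |c|)
    simpa using h.const_smul I
  have hvb : Tendsto (fun R : ℝ => I • ∫ y in (0 : ℝ)..c, f ((-R : ℝ) + y * I)) atTop (𝓝 0) := by
    have h : Tendsto (fun R : ℝ => ∫ y in (0 : ℝ)..c, f ((-R : ℝ) + y * I)) atTop (𝓝 0) :=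
      squeeze_zero_norm (fun R => hvert (-R))
        (by simpa using (hBb.comp tendsto_neg_atTop_atBot).mul_const |c|)
    simpa using h.const_smul I
  have e0 := intervalIntegral_tendsto_integral h0 tendsto_neg_atTop_atBot tendsto_id
  have ec := intervalIntegral_tendsto_integral hc tendsto_neg_atTop_atBot tendsto_id
  have key : ∀ R : ℝ, (∫ x : ℝ in (-R)..R, f (x + (0 : ℝ) * I))
      - (∫ x : ℝ in (-R)..R, f (x + c * I)) +
      I • (∫ y : ℝ in (0 : ℝ)..c, f (R + y * I)) -
      I • (∫ y : ℝ in (0 : ℝ)..c, f ((-R : ℝ) + y * I)) = 0 := by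
    intro R
    have := integral_boundary_rect_eq_zero_of_differentiableOn f ((-R : ℝ) : ℂ) (R + c * I)
      (hf.mono fun w hw => by
        have := hw.2
        simpa using this)
    simpa using this
  have hlim := ((e0.sub ec).add hvt).sub hvb
  simp only [id] at hlim
  have := tendsto_nhds_unique (hlim.congr key) tendsto_const_nhds |>.symm
  simp only [add_zero, sub_zero, ofReal_zero, zero_mul] at this
  exact (sub_eq_zero.1 this.symm).symm

/-- The Gamma integral with a complex scale `r`: in the coordinate `log t` the passage from `r = 1`
to `r` is a translation by `log r`, whose imaginary part `arg r` shifts the line of integration. -/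
theorem integral_cpow_mul_exp_neg_mul_Ioi_of_re_pos {s r : ℂ} (hs : 0 < s.re) (hr : 0 < r.re) :
    ∫ t : ℝ in Ioi 0, (t : ℂ) ^ (s - 1) * Complex.exp (-(r * t)) = Gamma s * r ^ (-s) := by
  have hr0 : r ≠ 0 := by rintro rfl; simp at hr
  set φ := r.arg with hφ
  have hφ2 : |φ| < Real.pi / 2 := abs_arg_lt_pi_div_two_iff.2 (Or.inl hr)
  have hcos : 0 < Real.cos φ := Real.cos_pos_of_mem_Ioo ⟨by linarith [abs_lt.1 hφ2], (abs_lt.1 hφ2).2⟩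
  have hexp : ∀ (q : ℂ) (a : ℝ), Real.exp a • (((Real.exp a : ℝ) : ℂ) ^ (s - 1) *
      Complex.exp (-(q * (Real.exp a : ℝ)))) =
      Complex.exp (s * a) * Complex.exp (-(q * Complex.exp a)) := by
    intro q a
    have h0 : ((Real.exp a : ℝ) : ℂ) ≠ 0 := by exact_mod_cast (Real.exp_pos a).ne'
    rw [real_smul, ← mul_assoc, cpow_def_of_ne_zero h0, ← ofReal_log (Real.exp_pos a).le,
      Real.log_exp, ofReal_exp, ← Complex.exp_add]
    congr 2; ring
  let f : ℂ → ℂ := fun w => Complex.exp (s * w) * Complex.exp (-Complex.exp w)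
  have hshift : ∫ a : ℝ, f (a + φ * I) = ∫ a : ℝ, f a := by
    refine integral_strip_shift
      (B := fun a => Real.exp (|s.im| * |φ|) *
        (Real.exp (s.re * a) * Real.exp (-(Real.cos φ * Real.exp a)))) ?_ ?_ ?_ ?_ ?_
    · exact Differentiable.differentiableOn (by fun_prop)
    · intro w hw
      have habs : |w.im| ≤ |φ| := by
        have := abs_sub_left_of_mem_uIcc hw
        simpa using this
      have h1 : Real.cos φ ≤ Real.cos w.im := by
        rw [← Real.cos_abs φ, ← Real.cos_abs w.im]
        exact Real.cos_le_cos_of_nonneg_of_le_pi (abs_nonneg _) (by linarith [Real.pi_pos]) habs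
      simp only [f]
      rw [norm_mul, Complex.norm_exp, Complex.norm_exp, ← Real.exp_add, ← Real.exp_add,
        ← Real.exp_add, Real.exp_le_exp]
      simp only [mul_re, neg_re, exp_re]
      have h2 : -(s.im * w.im) ≤ |s.im| * |φ| := by
        calc -(s.im * w.im) ≤ |s.im * w.im| := neg_le_abs _
          _ = |s.im| * |w.im| := abs_mul _ _
          _ ≤ _ := by gcongr
      nlinarith [mul_le_mul_of_nonneg_left h1 (Real.exp_pos w.re).le]
    · exact (integrable_exp_mul_exp_neg_exp hs hcos).const_mul _
    · simpa using (tendsto_exp_mul_exp_neg_exp_atTop s.re hcos).const_mul (Real.exp (|s.im| * |φ|))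
    · simpa using (tendsto_exp_mul_exp_neg_exp_atBot hs hcos).const_mul (Real.exp (|s.im| * |φ|))
  have hG : Gamma s = ∫ a : ℝ, f a := by
    rw [Gamma_eq_integral hs, GammaIntegral, integral_Ioi_eq_integral_exp]
    refine integral_congr_ae (Eventually.of_forall fun a => ?_)
    have := hexp 1 a
    simp only [one_mul] at this
    simp only [f]
    rw [← this, mul_comm (_ : ℂ) (_ ^ (s - 1)), ofReal_exp (-_), ofReal_neg]
  have hL : ∫ t : ℝ in Ioi 0, (t : ℂ) ^ (s - 1) * Complex.exp (-(r * t)) =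
      ∫ a : ℝ, Complex.exp (s * a) * Complex.exp (-(r * Complex.exp a)) := by
    rw [integral_Ioi_eq_integral_exp]
    exact integral_congr_ae (Eventually.of_forall fun a => hexp r a)
  have hlog : Complex.log r = (Real.log ‖r‖ : ℝ) + φ * I := rfl
  have h2 : ∫ a : ℝ, f (a + φ * I) = ∫ a : ℝ, f (((a + Real.log ‖r‖ : ℝ) : ℂ) + φ * I) :=
    (integral_add_right_eq_self (fun a : ℝ => f (a + φ * I)) (Real.log ‖r‖)).symm
  have h3 : ∀ a : ℝ, f (((a + Real.log ‖r‖ : ℝ) : ℂ) + φ * I) =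
      r ^ s * (Complex.exp (s * a) * Complex.exp (-(r * Complex.exp a))) := by
    intro a
    have e1 : (((a + Real.log ‖r‖ : ℝ) : ℂ) + φ * I) = a + Complex.log r := by
      rw [hlog]; push_cast; ring
    simp only [f]
    rw [e1, Complex.exp_add (a : ℂ), Complex.exp_log hr0, cpow_def_of_ne_zero hr0, mul_add,
      Complex.exp_add (s * a), mul_comm r, mul_comm (Complex.log r)]
    ring
  rw [hL, hG, ← hshift, h2]
  simp_rw [h3]
  rw [integral_const_mul, mul_comm, ← mul_assoc, cpow_neg, inv_mul_cancel₀, one_mul]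
  simp [cpow_eq_zero_iff, hr0]

/-! ### Recurrences for Hankel symbols -/

theorem hankel_neg (ν : ℂ) (j : ℕ) : hankel (-ν) j = hankel ν j := by
  unfold hankel
  rw [sub_neg_eq_add, ← sub_eq_add_neg]
  ring

/-- The three-term recurrence in the order that the Hankel symbols inherit from
`cosh ((ν + 1) θ) + cosh ((ν - 1) θ) = 2 cosh θ cosh (ν θ)`. -/
theorem hankel_add_one_add_hankel_sub_one (ν : ℂ) (j : ℕ) :
    hankel (ν + 1) (j + 1) + hankel (ν - 1) (j + 1) =
      2 * hankel ν (j + 1) + 4 * (j + 1 / 2) * hankel ν j := by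
  have hl : ∀ x : ℂ, ∀ i : ℕ, (ascPochhammer ℂ (i + 1)).eval x =
      x * (ascPochhammer ℂ i).eval (x + 1) := by
    intro x i
    rw [ascPochhammer_succ_left]
    simp [Polynomial.eval_comp]
  have hr : ∀ x : ℂ, ∀ i : ℕ, (ascPochhammer ℂ (i + 1)).eval x =
      (ascPochhammer ℂ i).eval x * (x + i) := fun x i => ascPochhammer_succ_eval i x
  -- the factor `1/2 + μ` moves between the two products, so that no division is needed
  have hstep : ∀ μ : ℂ, (ascPochhammer ℂ (j + 1)).eval (1 / 2 - (μ + 1)) *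
      (ascPochhammer ℂ (j + 1)).eval (1 / 2 + (μ + 1)) =
      -((ascPochhammer ℂ j).eval (1 / 2 - μ) * (ascPochhammer ℂ j).eval (1 / 2 + μ) *
        (1 / 2 + μ + j) * (1 / 2 + μ + (j + 1))) := by
    intro μ
    have h1 := hl (1 / 2 - (μ + 1)) j
    have h2 := hl (1 / 2 + μ) (j + 1)
    rw [hr, hr] at h2
    rw [show (1 / 2 - (μ + 1) + 1 : ℂ) = 1 / 2 - μ by ring] at h1
    rw [show (1 / 2 + μ + 1 : ℂ) = 1 / 2 + (μ + 1) by ring] at h2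
    push_cast at h2
    rw [h1]
    linear_combination (ascPochhammer ℂ j).eval (1 / 2 - μ) * h2
  have hp := hstep ν
  have hm := hstep (-ν)
  rw [show (1 / 2 - (-ν + 1) : ℂ) = 1 / 2 + (ν - 1) by ring,
    show (1 / 2 + (-ν + 1) : ℂ) = 1 / 2 - (ν - 1) by ring, sub_neg_eq_add,
    ← sub_eq_add_neg] at hm
  have hfac : (((j + 1).factorial : ℕ) : ℂ) = (j + 1) * (j.factorial : ℂ) := by
    push_cast [Nat.factorial_succ]; ring
  have hf0 : (j.factorial : ℂ) ≠ 0 := by exact_mod_cast j.factorial_ne_zero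
  have hj0 : (j + 1 : ℂ) ≠ 0 := by exact_mod_cast j.succ_ne_zero
  unfold hankel
  rw [mul_assoc, hp, mul_assoc _ (Polynomial.eval (1 / 2 - (ν - 1)) _),
    mul_comm (Polynomial.eval (1 / 2 - (ν - 1)) _), hm, hr, hr, hfac]
  field_simp
  ring

/-- The coefficient of `x ^ j` in the expansion of `cosh (ν θ) / cosh (θ / 2)` in powers of
`x = 2 cosh θ - 2`. -/
noncomputable def besselCoeff (ν : ℂ) (j : ℕ) : ℂ :=
  (Real.sqrt Real.pi : ℂ) * hankel ν j / (4 ^ j * Gamma (j + 1 / 2))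

theorem Gamma_nat_add_half_ne_zero (j : ℕ) : Gamma ((j : ℂ) + 1 / 2) ≠ 0 := by
  refine Gamma_ne_zero_of_re_pos ?_
  simp; positivity

theorem Gamma_nat_succ_add_half (j : ℕ) :
    Gamma (((j + 1 : ℕ) : ℂ) + 1 / 2) = (j + 1 / 2) * Gamma ((j : ℂ) + 1 / 2) := by
  rw [← Gamma_add_one]
  · congr 1; push_cast; ring
  · intro h
    have := congrArg re h
    simp at this
    have h2 : (0 : ℝ) ≤ j := j.cast_nonneg
    linarith

theorem besselCoeff_neg (ν : ℂ) (j : ℕ) : besselCoeff (-ν) j = besselCoeff ν j := by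
  rw [besselCoeff, hankel_neg, besselCoeff]

theorem besselCoeff_recurrence_zero (ν : ℂ) :
    besselCoeff (ν + 1) 0 + besselCoeff (ν - 1) 0 = 2 * besselCoeff ν 0 := by
  simp only [besselCoeff, hankel]
  simp
  ring

theorem besselCoeff_recurrence (ν : ℂ) (j : ℕ) :
    besselCoeff (ν + 1) (j + 1) + besselCoeff (ν - 1) (j + 1) =
      2 * besselCoeff ν (j + 1) + besselCoeff ν j := by
  have h := hankel_add_one_add_hankel_sub_one ν j
  have hG := Gamma_nat_add_half_ne_zero j
  have hj : (j + 1 / 2 : ℂ) ≠ 0 := by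
    intro h
    have h1 := congrArg re h
    simp at h1
    have h2 : (0 : ℝ) ≤ j := j.cast_nonneg
    linarith
  simp only [besselCoeff, Gamma_nat_succ_add_half]
  rw [← add_div, ← mul_add, h]
  generalize Gamma ((j : ℂ) + 1 / 2) = G at *
  generalize (j + 1 / 2 : ℂ) = m at *
  field_simp
  ring

theorem Gamma_nat_add_half_eq_ascPochhammer (j : ℕ) :
    Gamma ((j : ℂ) + 1 / 2) = Real.sqrt Real.pi * (ascPochhammer ℂ j).eval (1 / 2) := by
  induction j with
  | zero =>
    simp only [Nat.cast_zero, zero_add, ascPochhammer_zero, Polynomial.eval_one, mul_one]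
    rw [Gamma_one_half_eq, Real.sqrt_eq_rpow, ofReal_cpow Real.pi_pos.le]; norm_num
  | succ j ih => rw [Gamma_nat_succ_add_half, ih, ascPochhammer_succ_eval]; ring

theorem besselCoeff_zero_left (j : ℕ) :
    besselCoeff 0 j = Ring.choose (-1 / 2 : ℂ) j / 4 ^ j := by
  have h2 : (Real.sqrt Real.pi : ℂ) ≠ 0 := by
    exact_mod_cast (Real.sqrt_pos.2 Real.pi_pos).ne'
  have hf0 : (j.factorial : ℂ) ≠ 0 := by exact_mod_cast j.factorial_ne_zero
  have h3 : (ascPochhammer ℂ j).eval (1 / 2 : ℂ) ≠ 0 := by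
    have := Gamma_nat_add_half_ne_zero j
    rw [Gamma_nat_add_half_eq_ascPochhammer] at this
    exact right_ne_zero_of_mul this
  have h4 : Ring.choose (-1 / 2 : ℂ) j =
      (-1) ^ j * (ascPochhammer ℂ j).eval (1 / 2 : ℂ) / j.factorial := by
    rw [Ring.choose_eq_smul, Polynomial.descPochhammer_smeval_eq_ascPochhammer,
      Polynomial.ascPochhammer_smeval_cast, Polynomial.ascPochhammer_smeval_eq_eval]
    have := ascPochhammer_eval_neg_eq_descPochhammer (R := ℂ) (-1 / 2) j
    rw [descPochhammer_eval_eq_ascPochhammer] at this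
    rw [show (-(-1 / 2) : ℂ) = 1 / 2 by norm_num] at this
    rw [this, ← mul_assoc, ← pow_add, ← two_mul]
    simp [div_eq_inv_mul]
  rw [besselCoeff, hankel, Gamma_nat_add_half_eq_ascPochhammer, h4]
  simp only [sub_zero, add_zero]
  field_simp

/-! ### Asymptotic expansions with global remainders and Watson's lemma -/

/-- The coefficients of the product of `x` and the series with coefficients `c`. -/
def shiftCoeff (c : ℕ → ℂ) : ℕ → ℂ
  | 0 => 0
  | j + 1 => c j

/-- `HasExpansion f c N` says that `∑ c j x ^ j` is an asymptotic expansion of `f` at `0`, with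
remainders that are controlled on the whole half-line `x > 0`: the `J`-th one is
`O(x ^ J (1 + x) ^ N)`. -/
def HasExpansion (f : ℝ → ℂ) (c : ℕ → ℂ) (N : ℕ) : Prop :=
  ∀ J : ℕ, ∃ C : ℝ, 0 ≤ C ∧ ∀ x : ℝ, 0 < x →
    ‖f x - ∑ j ∈ Finset.range J, c j * (x : ℂ) ^ j‖ ≤ C * (x ^ J * (1 + x) ^ N)

namespace HasExpansion

variable {f g : ℝ → ℂ} {c d : ℕ → ℂ} {N : ℕ}

theorem mono {N' : ℕ} (h : HasExpansion f c N) (hN : N ≤ N') : HasExpansion f c N' := by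
  intro J
  obtain ⟨C, hC, h⟩ := h J
  refine ⟨C, hC, fun x hx => (h x hx).trans ?_⟩
  have : (1 + x) ^ N ≤ (1 + x) ^ N' := pow_le_pow_right₀ (by linarith) hN
  gcongr

theorem linear_comb (hf : HasExpansion f c N) (hg : HasExpansion g d N) (a b : ℂ) :
    HasExpansion (fun x => a * f x + b * g x) (fun j => a * c j + b * d j) N := by
  intro J
  obtain ⟨C, hC, hf⟩ := hf J
  obtain ⟨D, hD, hg⟩ := hg J
  refine ⟨‖a‖ * C + ‖b‖ * D, by positivity, fun x hx => ?_⟩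
  have e : a * f x + b * g x - ∑ j ∈ Finset.range J, (a * c j + b * d j) * (x : ℂ) ^ j =
      a * (f x - ∑ j ∈ Finset.range J, c j * (x : ℂ) ^ j) +
      b * (g x - ∑ j ∈ Finset.range J, d j * (x : ℂ) ^ j) := by
    simp only [add_mul, Finset.sum_add_distrib, mul_sub, Finset.mul_sum, mul_assoc]
    ring
  rw [e, add_mul]
  refine (norm_add_le _ _).trans ?_
  rw [norm_mul, norm_mul, mul_assoc, mul_assoc]
  gcongr
  · exact hf x hx
  · exact hg x hx

theorem mul_id (hf : HasExpansion f c N) :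
    HasExpansion (fun x => x * f x) (shiftCoeff c) (N + 1) := by
  intro J
  cases J with
  | zero =>
    obtain ⟨C, hC, hf⟩ := hf 0
    refine ⟨C, hC, fun x hx => ?_⟩
    have := hf x hx
    simp only [Finset.range_zero, Finset.sum_empty, sub_zero, pow_zero, one_mul] at this ⊢
    rw [norm_mul, norm_real, Real.norm_of_nonneg hx.le, pow_succ]
    have h1 : 0 ≤ (1 + x) ^ N := by positivity
    calc x * ‖f x‖ ≤ (1 + x) * (C * (1 + x) ^ N) := by gcongr; linarith
      _ = _ := by ring
  | succ J =>
    obtain ⟨C, hC, hf⟩ := hf J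
    refine ⟨C, hC, fun x hx => ?_⟩
    have e : (x : ℂ) * f x - ∑ j ∈ Finset.range (J + 1),
        shiftCoeff c j * (x : ℂ) ^ j =
        x * (f x - ∑ j ∈ Finset.range J, c j * (x : ℂ) ^ j) := by
      rw [Finset.sum_range_succ', mul_sub, Finset.mul_sum]
      change _ - (∑ j ∈ Finset.range J, c j * (x : ℂ) ^ (j + 1) + 0 * (x : ℂ) ^ 0) = _
      rw [zero_mul, add_zero]
      congr 1
      exact Finset.sum_congr rfl fun j _ => by ring
    rw [e, norm_mul, norm_real, Real.norm_of_nonneg hx.le]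
    calc x * _ ≤ x * (C * (x ^ J * (1 + x) ^ N)) := by gcongr; exact hf x hx
      _ = C * (x ^ (J + 1) * (1 + x) ^ N) := by ring
      _ ≤ _ := by
        have : (1 + x) ^ N ≤ (1 + x) ^ (N + 1) := pow_le_pow_right₀ (by linarith) (by lia)
        gcongr

/-- A bounded function with an asymptotic expansion at `0` has remainders `O(x ^ J)` on the whole
half-line: away from `0` both the function and the lower powers of `x` are `O(x ^ J)`. -/
theorem of_isBigO {M : ℝ} (hM : ∀ x : ℝ, 0 < x → ‖f x‖ ≤ M)
    (h : ∀ J : ℕ, (fun x : ℝ => f x - ∑ j ∈ Finset.range J, c j * (x : ℂ) ^ j) =O[𝓝[>] 0]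
      fun x => x ^ J) : HasExpansion f c 0 := by
  intro J
  obtain ⟨C, hC, hCb⟩ := (h J).exists_nonneg
  rw [Asymptotics.isBigOWith_iff] at hCb
  obtain ⟨δ, hδ, hδb⟩ := mem_nhdsGT_iff_exists_Ioo_subset.1 hCb
  have hδ : 0 < δ := hδ
  have hM0 : 0 ≤ M := (norm_nonneg _).trans (hM 1 one_pos)
  set D := M / δ ^ J + ∑ j ∈ Finset.range J, ‖c j‖ / δ ^ (J - j)
  have hD : 0 ≤ D := by positivity
  refine ⟨C + D, by positivity, fun x hx => ?_⟩
  rw [pow_zero, mul_one]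
  have hx0 : 0 ≤ x ^ J := by positivity
  rcases lt_or_ge x δ with hlt | hge
  · have := hδb ⟨hx, hlt⟩
    simp only [mem_ofPred_eq, Real.norm_of_nonneg hx0] at this
    nlinarith
  · have h1 : ∀ j ∈ Finset.range J, ‖c j * (x : ℂ) ^ j‖ ≤ ‖c j‖ / δ ^ (J - j) * x ^ J := by
      intro j hj
      rw [norm_mul, norm_pow, norm_real, Real.norm_of_nonneg hx.le, div_mul_eq_mul_div,
        mul_div_assoc]
      refine mul_le_mul_of_nonneg_left ?_ (norm_nonneg _)
      rw [le_div_iff₀ (by positivity)]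
      calc x ^ j * δ ^ (J - j) ≤ x ^ j * x ^ (J - j) := by gcongr
        _ = x ^ J := by rw [← pow_add]; congr 1; have := Finset.mem_range.1 hj; lia
    have h2 : M ≤ M / δ ^ J * x ^ J := by
      rw [div_mul_eq_mul_div, le_div_iff₀ (by positivity)]
      gcongr
    calc _ ≤ ‖f x‖ + ‖∑ j ∈ Finset.range J, c j * (x : ℂ) ^ j‖ := norm_sub_le _ _
      _ ≤ M / δ ^ J * x ^ J + ∑ j ∈ Finset.range J, ‖c j‖ / δ ^ (J - j) * x ^ J := by
          gcongr
          · exact (hM x hx).trans h2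
          · exact (norm_sum_le _ _).trans (Finset.sum_le_sum h1)
      _ = D * x ^ J := by rw [← Finset.sum_mul, ← add_mul]
      _ ≤ _ := by gcongr; linarith

end HasExpansion

/-- Watson's lemma with the weight `x ^ (-1/2)`, uniformly in the half-plane `1 ≤ Re b`. -/
theorem HasExpansion.watson {f : ℝ → ℂ} {c : ℕ → ℂ} {N : ℕ} (hf : HasExpansion f c N)
    (hcont : ContinuousOn f (Ioi 0)) (J : ℕ) :
    ∃ K : ℝ, 0 ≤ K ∧ ∀ b : ℂ, 1 ≤ b.re →
      ‖(∫ x : ℝ in Ioi 0, (x : ℂ) ^ (-1 / 2 : ℂ) * f x * Complex.exp (-(b * x)))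
        - ∑ j ∈ Finset.range J, c j * Gamma (j + 1 / 2) * b ^ (-(j + 1 / 2) : ℂ)‖
      ≤ K * b.re ^ (-(J + 1 / 2) : ℝ) := by
  have hmeas : ∀ b : ℂ, AEStronglyMeasurable
      (fun x : ℝ => (x : ℂ) ^ (-1 / 2 : ℂ) * f x * Complex.exp (-(b * x)))
      (volume.restrict (Ioi 0)) := by
    intro b
    refine ContinuousOn.aestronglyMeasurable ?_ measurableSet_Ioi
    refine (ContinuousOn.mul ?_ hcont).mul (by fun_prop)
    intro x hx
    refine ContinuousAt.continuousWithinAt ?_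
    exact continuousAt_ofReal_cpow_const x _ (Or.inr (ne_of_gt hx))
  have hint : ∀ p β : ℝ, -1 < p → 0 < β →
      IntegrableOn (fun x : ℝ => x ^ p * Real.exp (-(β * x))) (Ioi 0) := by
    intro p β hp hβ
    refine (integrableOn_rpow_mul_exp_neg_mul_rpow (p := 1) hp one_pos hβ).congr_fun
      (fun x _ => ?_) measurableSet_Ioi
    simp
  -- `(1 + x) ^ N ≤ 2 ^ N (1 + x ^ N)` splits the remainder into two Gamma integrals
  have hbound : ∀ (I : ℕ) (C : ℝ), 0 ≤ C → (∀ x : ℝ, 0 < x →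
      ‖f x - ∑ j ∈ Finset.range I, c j * (x : ℂ) ^ j‖ ≤ C * (x ^ I * (1 + x) ^ N)) →
      ∀ b : ℂ, ∀ x ∈ Ioi (0 : ℝ),
      ‖(x : ℂ) ^ (-1 / 2 : ℂ) * (f x - ∑ j ∈ Finset.range I, c j * (x : ℂ) ^ j) *
        Complex.exp (-(b * x))‖ ≤
      C * 2 ^ N * (x ^ (I - 1 / 2 : ℝ) * Real.exp (-(b.re * x)) +
        x ^ (I + N - 1 / 2 : ℝ) * Real.exp (-(b.re * x))) := by
    intro I C hC h b x hx
    have hx : 0 < x := hx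
    rw [norm_mul, norm_mul, Complex.norm_exp, norm_cpow_eq_rpow_re_of_pos hx]
    have e1 : (-(b * x)).re = -(b.re * x) := by simp
    have e2 : (-1 / 2 : ℂ).re = -1 / 2 := by simp
    rw [e1, e2]
    have h2 : (1 + x) ^ N ≤ 2 ^ N * (1 + x ^ N) := by
      rcases le_total x 1 with h1 | h1
      · calc (1 + x) ^ N ≤ 2 ^ N := by gcongr; linarith
          _ ≤ _ := le_mul_of_one_le_right (by positivity) (by linarith [pow_pos hx N])
      · calc (1 + x) ^ N ≤ (2 * x) ^ N := by gcongr; linarith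
          _ = 2 ^ N * x ^ N := mul_pow _ _ _
          _ ≤ _ := by gcongr; linarith
    have e3 : x ^ (I - 1 / 2 : ℝ) = x ^ (-1 / 2 : ℝ) * x ^ I := by
      rw [← Real.rpow_natCast, ← Real.rpow_add hx]; congr 1; ring
    have e4 : x ^ (I + N - 1 / 2 : ℝ) = x ^ (-1 / 2 : ℝ) * x ^ I * x ^ N := by
      rw [← Real.rpow_natCast, ← Real.rpow_natCast, ← Real.rpow_add hx, ← Real.rpow_add hx]
      congr 1; ring
    rw [e3, e4]
    calc _ ≤ x ^ (-1 / 2 : ℝ) * (C * (x ^ I * (2 ^ N * (1 + x ^ N)))) *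
            Real.exp (-(b.re * x)) := by
          have := h x hx
          gcongr
          exact this.trans (by gcongr)
      _ = _ := by ring
  have hI1 : ∀ (I : ℕ) (b : ℂ), 0 < b.re → IntegrableOn (fun x : ℝ =>
      (x ^ (I - 1 / 2 : ℝ) * Real.exp (-(b.re * x)) +
        x ^ (I + N - 1 / 2 : ℝ) * Real.exp (-(b.re * x)))) (Ioi 0) := by
    intro I b hb
    have hI : (0 : ℝ) ≤ I := I.cast_nonneg
    have hN : (0 : ℝ) ≤ N := N.cast_nonneg
    exact (hint _ _ (by linarith) hb).add (hint _ _ (by linarith) hb)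
  obtain ⟨C, hC, hfJ⟩ := hf J
  obtain ⟨C0, hC0, hf0⟩ := hf 0
  have hJ : (0 : ℝ) ≤ J := J.cast_nonneg
  have hN : (0 : ℝ) ≤ N := N.cast_nonneg
  have hG1 := Real.Gamma_pos_of_pos (s := (J + 1 / 2 : ℝ)) (by positivity)
  have hG2 := Real.Gamma_pos_of_pos (s := (J + N + 1 / 2 : ℝ)) (by positivity)
  refine ⟨C * 2 ^ N * (Real.Gamma (J + 1 / 2) + Real.Gamma (J + N + 1 / 2)),
    by positivity, fun b hb => ?_⟩
  have hb0 : 0 < b.re := by linarith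
  have hmono : ∀ j : ℕ, ∀ x ∈ Ioi (0 : ℝ), (x : ℂ) ^ (-1 / 2 : ℂ) * (c j * (x : ℂ) ^ j) *
      Complex.exp (-(b * x)) =
      c j * ((x : ℂ) ^ ((j + 1 / 2 : ℂ) - 1) * Complex.exp (-(b * x))) := by
    intro j x hx
    have hx0 : (x : ℂ) ≠ 0 := by exact_mod_cast (ne_of_gt hx)
    rw [show ((j + 1 / 2 : ℂ) - 1) = (-1 / 2 : ℂ) + j by ring, cpow_add _ _ hx0, cpow_natCast]
    ring
  have hjint : ∀ j : ℕ, IntegrableOn (fun x : ℝ => (x : ℂ) ^ (-1 / 2 : ℂ) *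
      (c j * (x : ℂ) ^ j) * Complex.exp (-(b * x))) (Ioi 0) := by
    intro j
    have hj : (0 : ℝ) ≤ j := j.cast_nonneg
    refine Integrable.mono' ((hint (j - 1 / 2) b.re (by linarith) hb0).const_mul ‖c j‖) ?_ ?_
    · refine ContinuousOn.aestronglyMeasurable ?_ measurableSet_Ioi
      refine (ContinuousOn.mul ?_ (by fun_prop)).mul (by fun_prop)
      intro x hx
      exact (continuousAt_ofReal_cpow_const x _ (Or.inr (ne_of_gt hx))).continuousWithinAt
    · filter_upwards [ae_restrict_mem measurableSet_Ioi] with x hx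
      rw [hmono j x hx, norm_mul, norm_mul, Complex.norm_exp, norm_cpow_eq_rpow_re_of_pos hx]
      refine le_of_eq ?_
      congr 3
      · simp; ring
      · simp
  have hfint : IntegrableOn (fun x : ℝ => (x : ℂ) ^ (-1 / 2 : ℂ) * f x *
      Complex.exp (-(b * x))) (Ioi 0) := by
    refine Integrable.mono' ((hI1 0 b hb0).const_mul (C0 * 2 ^ N)) (hmeas b) ?_
    filter_upwards [ae_restrict_mem measurableSet_Ioi] with x hx
    simpa using hbound 0 C0 hC0 hf0 b x hx
  have hsum : ∑ j ∈ Finset.range J, c j * Gamma (j + 1 / 2) * b ^ (-(j + 1 / 2) : ℂ) =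
      ∫ x : ℝ in Ioi 0, ∑ j ∈ Finset.range J, (x : ℂ) ^ (-1 / 2 : ℂ) * (c j * (x : ℂ) ^ j) *
        Complex.exp (-(b * x)) := by
    rw [integral_finsetSum _ fun j _ => hjint j]
    refine Finset.sum_congr rfl fun j _ => ?_
    rw [setIntegral_congr_fun measurableSet_Ioi (hmono j), integral_const_mul,
      integral_cpow_mul_exp_neg_mul_Ioi_of_re_pos (by simp; positivity) hb0, mul_assoc]
  rw [hsum, ← integral_sub hfint (integrable_finsetSum _ fun j _ => hjint j)]
  have hle : ‖∫ x : ℝ in Ioi 0, ((x : ℂ) ^ (-1 / 2 : ℂ) * f x * Complex.exp (-(b * x)) -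
      ∑ j ∈ Finset.range J, (x : ℂ) ^ (-1 / 2 : ℂ) * (c j * (x : ℂ) ^ j) *
        Complex.exp (-(b * x)))‖ ≤ ∫ x : ℝ in Ioi 0,
      C * 2 ^ N * (x ^ (J - 1 / 2 : ℝ) * Real.exp (-(b.re * x)) +
        x ^ (J + N - 1 / 2 : ℝ) * Real.exp (-(b.re * x))) := by
    refine norm_integral_le_of_norm_le ((hI1 J b hb0).const_mul _) ?_
    filter_upwards [ae_restrict_mem measurableSet_Ioi] with x hx
    refine le_of_eq_of_le ?_ (hbound J C hC hfJ b x hx)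
    rw [mul_sub, sub_mul, Finset.mul_sum, Finset.sum_mul]
  refine hle.trans ?_
  rw [integral_const_mul, integral_add (hint _ _ (by linarith) hb0) (hint _ _ (by linarith) hb0),
    show (J - 1 / 2 : ℝ) = (J + 1 / 2) - 1 by ring,
    show (J + N - 1 / 2 : ℝ) = (J + N + 1 / 2) - 1 by ring,
    Real.integral_rpow_mul_exp_neg_mul_Ioi (by positivity) hb0,
    Real.integral_rpow_mul_exp_neg_mul_Ioi (by positivity) hb0, one_div b.re,
    Real.inv_rpow hb0.le, Real.inv_rpow hb0.le, ← Real.rpow_neg hb0.le, ← Real.rpow_neg hb0.le]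
  have hp : b.re ^ (-(J + N + 1 / 2) : ℝ) ≤ b.re ^ (-(J + 1 / 2) : ℝ) :=
    Real.rpow_le_rpow_of_exponent_le hb (by linarith)
  rw [mul_assoc (C * 2 ^ N) (_ + _)]
  refine mul_le_mul_of_nonneg_left ?_ (by positivity)
  rw [add_mul]
  nlinarith

/-! ### The Hankel expansion of the Bessel function `K` -/

/-- `cosh (ν θ) / cosh (θ / 2)` as a function of `x = 2 cosh θ - 2`, where `cosh (ν θ)` is the
Chebyshev polynomial `T ν` at `cosh θ = 1 + x / 2`. -/
noncomputable def besselDensity (ν : ℕ) (x : ℝ) : ℂ :=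
  (((Polynomial.Chebyshev.T ℝ ν).eval (1 + x / 2) * (1 + x / 4) ^ (-1 / 2 : ℝ) : ℝ) : ℂ)

/-- `T₁(1 + x / 2) = 1 + x / 2`, with the two terms as a linear combination of `besselDensity 0` and
its product with `x`. -/
theorem besselDensity_one (x : ℝ) :
    besselDensity 1 x = 1 * besselDensity 0 x + 1 / 2 * (x * besselDensity 0 x) := by
  simp only [besselDensity, Nat.cast_one, Nat.cast_zero, Polynomial.Chebyshev.T_one,
    Polynomial.Chebyshev.T_zero, Polynomial.eval_X, Polynomial.eval_one]
  push_cast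
  ring

/-- The Chebyshev recurrence, grouped as a combination of `besselDensity (ν + 1)`, its product with
`x`, and `besselDensity ν`. -/
theorem besselDensity_add_two (ν : ℕ) (x : ℝ) :
    besselDensity (ν + 2) x = 1 * (2 * besselDensity (ν + 1) x +
      1 * (x * besselDensity (ν + 1) x)) + (-1) * besselDensity ν x := by
  simp only [besselDensity]
  push_cast [Polynomial.Chebyshev.T_add_two]
  simp only [Polynomial.eval_sub, Polynomial.eval_mul, Polynomial.eval_X, Polynomial.eval_ofNat]
  push_cast
  ring

theorem hasExpansion_besselDensity_zero :
    HasExpansion (besselDensity 0) (besselCoeff 0) 0 := by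
  refine HasExpansion.of_isBigO (M := 1) ?_ ?_
  · intro x hx
    simp only [besselDensity, Nat.cast_zero, Polynomial.Chebyshev.T_zero, Polynomial.eval_one,
      one_mul]
    rw [norm_real, Real.norm_of_nonneg (by positivity)]
    exact Real.rpow_le_one_of_one_le_of_nonpos (by linarith) (by norm_num)
  · intro J
    have h := (Complex.one_add_cpow_hasFPowerSeriesAt_zero
      (a := (-1 / 2 : ℂ))).isBigO_sub_partialSum_pow J
    have ht : Tendsto (fun x : ℝ => (x : ℂ) / 4) (𝓝[>] 0) (𝓝 0) := by
      have : ContinuousAt (fun x : ℝ => (x : ℂ) / 4) 0 := by fun_prop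
      simpa using this.tendsto.mono_left (nhdsWithin_le_nhds (s := Ioi 0))
    have h' := h.comp_tendsto ht
    refine (h'.congr' ?_ EventuallyEq.rfl).trans ?_
    · filter_upwards [self_mem_nhdsWithin] with x hx
      have hx : 0 < x := hx
      simp only [Function.comp, zero_add, FormalMultilinearSeries.partialSum, besselDensity,
        Nat.cast_zero, Polynomial.Chebyshev.T_zero, Polynomial.eval_one, one_mul,
        binomialSeries_apply, List.ofFn_const, List.prod_replicate, smul_eq_mul,
        besselCoeff_zero_left]
      congr 1
      · rw [ofReal_cpow (by positivity)]; push_cast; rfl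
      · refine Finset.sum_congr rfl fun j _ => ?_
        rw [div_pow]; ring
    · refine Asymptotics.IsBigO.of_bound 1 ?_
      filter_upwards [self_mem_nhdsWithin] with x hx
      have hx : 0 < x := hx
      simp only [Function.comp, norm_pow, norm_norm, one_mul, norm_div, norm_real]
      gcongr
      rw [div_le_iff₀ (by norm_num)]
      have := norm_nonneg x
      norm_num
      linarith [abs_nonneg x]

theorem hasExpansion_besselDensity (ν : ℕ) :
    HasExpansion (besselDensity ν) (besselCoeff ν) ν := by
  induction ν using Nat.twoStepInduction with
  | zero => simpa using hasExpansion_besselDensity_zero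
  | one =>
    have h0 := hasExpansion_besselDensity_zero
    have h := (h0.mono zero_le_one).linear_comb h0.mul_id 1 (1 / 2)
    have e1 := funext besselDensity_one
    rw [e1]
    convert h using 1
    ext j
    cases j with
    | zero =>
      have := besselCoeff_recurrence_zero 0
      rw [zero_add, zero_sub, besselCoeff_neg] at this
      simp only [Nat.cast_one, shiftCoeff]
      linear_combination this / 2
    | succ j =>
      have := besselCoeff_recurrence 0 j
      rw [zero_add, zero_sub, besselCoeff_neg] at this
      simp only [Nat.cast_one, shiftCoeff]
      linear_combination this / 2
  | more ν h0 h1 =>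
    have h := ((h1.mono (Nat.le_succ _)).linear_comb h1.mul_id 2 1).linear_comb
      (h0.mono (show ν ≤ ν + 1 + 1 by lia)) 1 (-1)
    rw [funext (besselDensity_add_two ν)]
    convert h using 1
    ext j
    cases j with
    | zero =>
      have := besselCoeff_recurrence_zero (ν + 1)
      rw [add_sub_cancel_right] at this
      push_cast
      rw [show (ν + 2 : ℂ) = ν + 1 + 1 by ring]
      simp only [shiftCoeff]
      linear_combination this
    | succ j =>
      have := besselCoeff_recurrence (ν + 1) j
      rw [add_sub_cancel_right] at this
      push_cast
      rw [show (ν + 2 : ℂ) = ν + 1 + 1 by ring]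
      simp only [shiftCoeff]
      linear_combination this

theorem continuousOn_besselDensity (ν : ℕ) : ContinuousOn (besselDensity ν) (Ioi 0) := by
  refine continuous_ofReal.comp_continuousOn ?_
  refine ContinuousOn.mul (by fun_prop) ?_
  refine ContinuousOn.rpow_const (by fun_prop) fun x hx => Or.inl ?_
  have : 0 < x := hx
  positivity

theorem integrable_exp_mul_exp_neg_cosh {ν : ℝ} (hν : 0 < ν) {z : ℂ} (hz : 0 < z.re) :
    Integrable (fun θ : ℝ => Complex.exp (ν * θ) * Complex.exp (-(z * Real.cosh θ))) := by
  refine (integrable_exp_mul_exp_neg_exp hν (half_pos hz)).mono'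
    (Continuous.aestronglyMeasurable (by fun_prop)) (Eventually.of_forall fun θ => ?_)
  rw [norm_mul, Complex.norm_exp, Complex.norm_exp]
  have e1 : ((ν : ℂ) * θ).re = ν * θ := by simp
  have e2 : (-(z * Real.cosh θ)).re = -(z.re * Real.cosh θ) := by
    rw [neg_re, re_mul_ofReal]
  rw [e1, e2]
  refine mul_le_mul_of_nonneg_left (Real.exp_le_exp.2 ?_) (Real.exp_pos _).le
  rw [Real.cosh_eq]
  nlinarith [Real.exp_pos (-θ)]

/-- The integral `2 K_ν(z)` as a Laplace transform in the variable `x = 2 cosh θ - 2`. -/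
theorem integral_exp_mul_exp_neg_cosh (ν : ℕ) (hν : 0 < ν) {z : ℂ} (hz : 0 < z.re) :
    ∫ θ : ℝ, Complex.exp (ν * θ) * Complex.exp (-(z * Real.cosh θ)) =
      Complex.exp (-z) * ∫ x : ℝ in Ioi 0, (x : ℂ) ^ (-1 / 2 : ℂ) * besselDensity ν x *
        Complex.exp (-(z / 2 * x)) := by
  have hint : Integrable (fun θ : ℝ => Complex.exp (ν * θ) * Complex.exp (-(z * Real.cosh θ))) := by
    simpa using integrable_exp_mul_exp_neg_cosh (ν := ν) (by exact_mod_cast hν) hz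
  have hint' := hint.comp_neg
  have h1 : ∫ θ : ℝ, Complex.exp (ν * θ) * Complex.exp (-(z * Real.cosh θ)) =
      ∫ θ : ℝ in Ioi 0, 2 * Complex.cosh (ν * θ) * Complex.exp (-(z * Real.cosh θ)) := by
    rw [← intervalIntegral.integral_Iic_add_Ioi hint.integrableOn (b := 0) hint.integrableOn,
      ← neg_zero, ← integral_comp_neg_Ioi, neg_zero,
      ← integral_add hint'.integrableOn hint.integrableOn]
    refine setIntegral_congr_fun measurableSet_Ioi fun θ _ => ?_
    simp only [Complex.cosh, Real.cosh_neg]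
    push_cast
    rw [mul_neg]
    ring
  have himg : (fun θ : ℝ => 2 * Real.cosh θ - 2) '' Ioi 0 = Ioi 0 := by
    ext x
    constructor
    · rintro ⟨θ, hθ, rfl⟩
      have := Real.one_lt_cosh.2 (ne_of_gt hθ)
      simp only [mem_Ioi]; linarith
    · intro hx
      have hx : 0 < x := hx
      refine ⟨Real.arcosh (1 + x / 2), Real.arcosh_pos (by linarith), ?_⟩
      simp only
      rw [Real.cosh_arcosh (by linarith)]; ring
  have hinj : InjOn (fun θ : ℝ => 2 * Real.cosh θ - 2) (Ioi 0) := by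
    intro a ha b hb hab
    refine Real.cosh_strictMonoOn.injOn (Ioi_subset_Ici_self ha) (Ioi_subset_Ici_self hb) ?_
    simp only at hab
    linarith
  have hcov := integral_image_eq_integral_abs_deriv_smul (s := Ioi 0)
    (f := fun θ : ℝ => 2 * Real.cosh θ - 2) (f' := fun θ => 2 * Real.sinh θ) measurableSet_Ioi
    (fun θ _ => (((Real.hasDerivAt_cosh θ).const_mul 2).sub_const 2).hasDerivWithinAt) hinj
    (fun x : ℝ => (x : ℂ) ^ (-1 / 2 : ℂ) * besselDensity ν x * Complex.exp (-(z / 2 * x)))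
  rw [himg] at hcov
  rw [h1, hcov, ← integral_const_mul]
  refine setIntegral_congr_fun measurableSet_Ioi fun θ hθ => ?_
  have hθ : 0 < θ := hθ
  have hs : 0 < Real.sinh θ := Real.sinh_pos_iff.2 hθ
  have hc : 1 < Real.cosh θ := Real.one_lt_cosh.2 hθ.ne'
  have hx0 : 0 < 2 * Real.cosh θ - 2 := by linarith
  simp only [besselDensity]
  rw [abs_of_pos (by positivity), show 1 + (2 * Real.cosh θ - 2) / 2 = Real.cosh θ by ring,
    Polynomial.Chebyshev.T_real_cosh]
  have hprod : (2 * Real.cosh θ - 2) ^ (-1 / 2 : ℝ) *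
      (1 + (2 * Real.cosh θ - 2) / 4) ^ (-1 / 2 : ℝ) * Real.sinh θ = 1 := by
    rw [← Real.mul_rpow hx0.le (by linarith)]
    have : (2 * Real.cosh θ - 2) * (1 + (2 * Real.cosh θ - 2) / 4) = Real.sinh θ ^ (2 : ℝ) := by
      rw [Real.rpow_two]
      linear_combination Real.cosh_sq θ
    rw [this, ← Real.rpow_mul hs.le, ← Real.rpow_add_one hs.ne']
    norm_num
  have e1 : ((2 * Real.cosh θ - 2 : ℝ) : ℂ) ^ (-1 / 2 : ℂ) =
      (((2 * Real.cosh θ - 2) ^ (-1 / 2 : ℝ) : ℝ) : ℂ) := by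
    rw [ofReal_cpow hx0.le]; push_cast; rfl
  have e2 : Complex.exp (-(z * Real.cosh θ)) =
      Complex.exp (-z) * Complex.exp (-(z / 2 * (2 * Real.cosh θ - 2 : ℝ))) := by
    rw [← Complex.exp_add]; congr 1; push_cast; ring
  rw [e1, e2, real_smul]
  have hprod' := congrArg (fun t : ℝ => (t : ℂ)) hprod
  push_cast at hprod' ⊢
  linear_combination (-2 * Complex.cosh (ν * θ) * Complex.exp (-z) *
    Complex.exp (-(z / 2 * (2 * Complex.cosh θ - 2)))) * hprod'

/-- The large-argument expansion of the Bessel function `2 K_ν(z)`, uniformly in the half-plane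
`2 ≤ Re z`. -/
theorem bessel_expansion (ν : ℕ) (hν : 0 < ν) (J : ℕ) :
    ∃ K : ℝ, 0 ≤ K ∧ ∀ z : ℂ, 2 ≤ z.re →
      ‖(∫ θ : ℝ, Complex.exp (ν * θ) * Complex.exp (-(z * Real.cosh θ))) -
        Complex.exp (-z) * ∑ j ∈ Finset.range J,
          (Real.sqrt Real.pi * hankel ν j / 4 ^ j) * (z / 2) ^ (-(j + 1 / 2) : ℂ)‖ ≤
      K * (Real.exp (-z.re) * (z.re / 2) ^ (-(J + 1 / 2) : ℝ)) := by
  obtain ⟨K, hK, h⟩ := (hasExpansion_besselDensity ν).watson (continuousOn_besselDensity ν) J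
  refine ⟨K, hK, fun z hz => ?_⟩
  have hre : (z / 2).re = z.re / 2 := by simp
  have := h (z / 2) (by rw [hre]; linarith)
  rw [integral_exp_mul_exp_neg_cosh ν hν (by linarith), ← mul_sub, norm_mul, Complex.norm_exp,
    neg_re, ← mul_assoc K, mul_comm K, mul_assoc]
  refine mul_le_mul_of_nonneg_left ?_ (Real.exp_pos _).le
  rw [hre] at this
  have hc : ∀ j : ℕ, besselCoeff ν j * Gamma (j + 1 / 2) =
      Real.sqrt Real.pi * hankel ν j / 4 ^ j := fun j => by
    rw [besselCoeff, ← div_div, div_mul_cancel₀ _ (Gamma_nat_add_half_ne_zero _)]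
  simpa only [hc] using this

/-! ### The function `λ` and the coefficients `P_k` and `C̃_l` -/

theorem exp_sub_one_ne_zero_of_re_ne_zero {u : ℂ} (hu : u.re ≠ 0) : Complex.exp u - 1 ≠ 0 := by
  intro h
  have h1 : ‖Complex.exp u‖ = 1 := by rw [sub_eq_zero.1 h]; simp
  rw [Complex.norm_exp, Real.exp_eq_one_iff] at h1
  exact hu h1

theorem exp_sub_one_eventually_ne_zero : ∀ᶠ u : ℂ in 𝓝[≠] 0, Complex.exp u - 1 ≠ 0 := by
  have h : HasDerivAt (fun u : ℂ => Complex.exp u - 1) 1 0 := by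
    simpa using (Complex.hasDerivAt_exp 0).sub_const 1
  simpa using h.eventually_ne (c := 0) one_ne_zero

theorem lam_zero : lam 0 = 0 := if_pos rfl

theorem lam_of_ne {u : ℂ} (hu : u ≠ 0) : lam u = 1 / (Complex.exp u - 1) - 1 / u + 1 / 2 :=
  if_neg hu

theorem tendsto_lam : Tendsto lam (𝓝[≠] 0) (𝓝 0) := by
  -- with `r = e ^ u - 1 - u - u ^ 2 / 2 = O(u ^ 3)` the numerator of `lam u` over the common
  -- denominator `u (e ^ u - 1)` is `u ^ 3 / 4 + (u / 2 - 1) r`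
  have hbig : ∀ᶠ u : ℂ in 𝓝[≠] 0, ‖lam u‖ ≤ 8 * ‖u‖ := by
    have hball : ∀ᶠ u : ℂ in 𝓝[≠] (0 : ℂ), ‖u‖ < 1 / 2 :=
      nhdsWithin_le_nhds (by
        filter_upwards [Metric.ball_mem_nhds (0 : ℂ) (by norm_num : (0 : ℝ) < 1 / 2)] with u hu
        simpa using hu)
    filter_upwards [hball, exp_sub_one_eventually_ne_zero, self_mem_nhdsWithin] with u hu he hu0
    have hu0 : u ≠ 0 := hu0
    have hr := Complex.exp_bound (x := u) (by linarith) (n := 3) (by norm_num)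
    simp only [Finset.sum_range_succ, Finset.sum_range_zero, Nat.factorial] at hr
    norm_num at hr
    set r := Complex.exp u - (1 + u + u ^ 2 / 2) with hrdef
    have he1 : Complex.exp u - 1 = u + u ^ 2 / 2 + r := by rw [hrdef]; ring
    have hn : 0 < ‖u‖ := norm_pos_iff.2 hu0
    have hr' : ‖r‖ ≤ ‖u‖ ^ 3 * (2 / 9) := by simpa using hr
    have hden : ‖u‖ / 2 ≤ ‖Complex.exp u - 1‖ := by
      have h1 : ‖u‖ - ‖u ^ 2 / 2 + r‖ ≤ ‖Complex.exp u - 1‖ := by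
        have := norm_sub_norm_le u (-(u ^ 2 / 2 + r))
        rw [norm_neg] at this
        rwa [he1, show u + u ^ 2 / 2 + r = u - -(u ^ 2 / 2 + r) by ring]
      have h2 : ‖u ^ 2 / 2 + r‖ ≤ ‖u‖ ^ 2 / 2 + ‖u‖ ^ 3 * (2 / 9) := by
        refine (norm_add_le _ _).trans (add_le_add (by simp) hr')
      nlinarith [pow_pos hn 2, pow_pos hn 3, mul_pos hn hn]
    have hnum : lam u = (u ^ 3 / 4 + (u / 2 - 1) * r) / (u * (Complex.exp u - 1)) := by
      have hr2 : r = (Complex.exp u - 1) - u - u ^ 2 / 2 := by linear_combination -he1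
      rw [lam_of_ne hu0, hr2]
      clear_value r
      clear hr2 hden he1 hrdef
      generalize Complex.exp u - 1 = d at he ⊢
      field_simp
      ring
    have hnn : ‖u ^ 3 / 4 + (u / 2 - 1) * r‖ ≤ 4 * ‖u‖ ^ 3 := by
      have h1 : ‖u / 2 - 1‖ ≤ 2 := by
        refine (norm_sub_le _ _).trans ?_
        simp
        linarith
      calc _ ≤ ‖u ^ 3 / 4‖ + ‖(u / 2 - 1) * r‖ := norm_add_le _ _
        _ ≤ ‖u‖ ^ 3 / 4 + 2 * (‖u‖ ^ 3 * (2 / 9)) := by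
            rw [norm_mul]
            gcongr
            simp
        _ ≤ _ := by nlinarith [pow_pos hn 3]
    rw [hnum, norm_div, norm_mul, div_le_iff₀ (mul_pos hn (norm_pos_iff.2 he))]
    calc _ ≤ 4 * ‖u‖ ^ 3 := hnn
      _ = 8 * ‖u‖ * (‖u‖ * (‖u‖ / 2)) := by ring
      _ ≤ _ := by gcongr
  refine squeeze_zero_norm' hbig ?_
  have : ContinuousAt (fun u : ℂ => 8 * ‖u‖) 0 := by fun_prop
  simpa using this.tendsto.mono_left (nhdsWithin_le_nhds (s := {0}ᶜ))

theorem analyticAt_lam : AnalyticAt ℂ lam 0 := by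
  refine Complex.analyticAt_of_differentiable_on_punctured_nhds_of_continuousAt ?_ ?_
  · filter_upwards [exp_sub_one_eventually_ne_zero, self_mem_nhdsWithin] with u he hu0
    have hu0 : u ≠ 0 := hu0
    have : DifferentiableAt ℂ (fun u : ℂ => 1 / (Complex.exp u - 1) - 1 / u + 1 / 2) u := by
      fun_prop (disch := assumption)
    refine this.congr_of_eventuallyEq ?_
    filter_upwards [isOpen_ne.mem_nhds hu0] with v hv using lam_of_ne hv
  · rw [continuousAt_iff_punctured_nhds, lam_zero]
    exact tendsto_lam

/-- `λ` is bounded on the sector `|arg u| ≤ π / 4`, which avoids its poles `2πi k`, `k ≠ 0`. -/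
theorem exists_lam_bound : ∃ M : ℝ, 0 ≤ M ∧ ∀ u : ℂ, 0 < u.re → |u.im| ≤ u.re → ‖lam u‖ ≤ M := by
  have hc : ∀ᶠ u : ℂ in 𝓝 0, ‖lam u‖ < 1 := by
    have := analyticAt_lam.continuousAt.norm.tendsto
    rw [lam_zero, norm_zero] at this
    exact this.eventually_lt_const one_pos
  obtain ⟨δ, hδ, hδb⟩ := Metric.eventually_nhds_iff.1 hc
  refine ⟨1 + (2 / δ + 1 / δ + 1 / 2), by positivity, fun u hu him => ?_⟩
  rcases lt_or_ge ‖u‖ δ with h | h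
  · have := hδb (y := u) (by simpa using h)
    have h3 : 0 ≤ 2 / δ + 1 / δ + 1 / 2 := by positivity
    linarith
  · have hu0 : u ≠ 0 := by rintro rfl; simp at hu
    have h1 : δ / 2 ≤ u.re := by
      have := Complex.norm_le_abs_re_add_abs_im u
      rw [abs_of_pos hu] at this
      linarith
    have h2 : δ / 2 ≤ ‖Complex.exp u - 1‖ := by
      have := norm_sub_norm_le (Complex.exp u) 1
      rw [Complex.norm_exp, norm_one] at this
      linarith [Real.add_one_le_exp u.re]
    rw [lam_of_ne hu0]
    have h3 : ‖1 / (Complex.exp u - 1)‖ ≤ 2 / δ := by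
      rw [norm_div, norm_one, div_le_div_iff₀ (by linarith) hδ]
      linarith
    have h4 : ‖1 / u‖ ≤ 1 / δ := by
      rw [norm_div, norm_one]
      exact one_div_le_one_div_of_le hδ h
    calc _ ≤ ‖1 / (Complex.exp u - 1)‖ + ‖1 / u‖ + ‖(1 / 2 : ℂ)‖ :=
          (norm_add_le _ _).trans (add_le_add_left (norm_sub_le _ _) _)
      _ ≤ 2 / δ + 1 / δ + 1 / 2 := by
          gcongr
          norm_num
      _ ≤ _ := by linarith

theorem hasFPowerSeriesAt_exp_lam (z : ℂ) :
    HasFPowerSeriesAt (fun u : ℂ => Complex.exp (-z * lam u))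
      (FormalMultilinearSeries.ofScalars ℂ (fun k => P k z)) 0 := by
  have : AnalyticAt ℂ (fun u : ℂ => Complex.exp (-z * lam u)) 0 :=
    (analyticAt_const.mul analyticAt_lam).cexp
  exact this.hasFPowerSeriesAt

/-- The Taylor series of `e ^ (-z λ(u))` at `0` along a ray in the sector `|arg u| ≤ π / 4`, with
remainders controlled on the whole ray. -/
theorem hasExpansion_exp_lam (z : ℂ) {ω : ℂ} (hω : 0 < ω.re) (hω' : |ω.im| ≤ ω.re) :
    HasExpansion (fun x => Complex.exp (-z * lam (ω * x))) (fun k => P k z * ω ^ k) 0 := by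
  obtain ⟨M, hM, hlam⟩ := exists_lam_bound
  refine HasExpansion.of_isBigO (M := Real.exp (‖z‖ * M)) ?_ ?_
  · intro x hx
    refine (Complex.norm_exp_le_exp_norm _).trans ?_
    rw [norm_mul, norm_neg]
    gcongr
    refine hlam _ ?_ ?_
    · rw [re_mul_ofReal]; positivity
    · rw [re_mul_ofReal, im_mul_ofReal, abs_mul, abs_of_pos hx]; gcongr
  · intro J
    have h := (hasFPowerSeriesAt_exp_lam z).isBigO_sub_partialSum_pow J
    have ht : Tendsto (fun x : ℝ => ω * (x : ℂ)) (𝓝[>] 0) (𝓝 0) := by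
      have : ContinuousAt (fun x : ℝ => ω * (x : ℂ)) 0 := by fun_prop
      simpa using this.tendsto.mono_left (nhdsWithin_le_nhds (s := Ioi 0))
    have h' := h.comp_tendsto ht
    refine (h'.congr_left ?_).trans ?_
    · intro x
      simp only [Function.comp, zero_add, FormalMultilinearSeries.partialSum,
        FormalMultilinearSeries.ofScalars_apply_eq, smul_eq_mul, mul_pow]
      congr 1
      exact Finset.sum_congr rfl fun j _ => by ring
    · refine Asymptotics.IsBigO.of_bound (‖ω‖ ^ J) (Eventually.of_forall fun x => ?_)
      simp [mul_pow]

/-- `λ` is odd near `0`. At its poles the value of `lam` is a junk value, so that oddness fails there;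
the derivatives at `0` do not see this. -/
theorem P_neg (k : ℕ) (z : ℂ) : P k (-z) = (-1) ^ k * P k z := by
  have h : (fun u : ℂ => Complex.exp (-(-z) * lam u)) =ᶠ[𝓝 0]
      fun u : ℂ => (fun v : ℂ => Complex.exp (-z * lam v)) (-u) := by
    filter_upwards [eventually_nhdsWithin_iff.1 exp_sub_one_eventually_ne_zero] with u hu
    rcases eq_or_ne u 0 with rfl | hu0
    · simp [lam_zero]
    · have he := hu hu0
      have hodd : lam (-u) = -lam u := by
        rw [lam_of_ne hu0, lam_of_ne (neg_ne_zero.2 hu0), Complex.exp_neg]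
        have he0 := Complex.exp_ne_zero u
        have he' : (Complex.exp u)⁻¹ - 1 ≠ 0 := by
          intro h
          apply he
          field_simp at h
          linear_combination -h
        have h1 : 1 / ((Complex.exp u)⁻¹ - 1) = -1 - 1 / (Complex.exp u - 1) := by
          have he'' : 1 - Complex.exp u ≠ 0 := fun h => he (by linear_combination -h)
          rw [show (Complex.exp u)⁻¹ - 1 = -(Complex.exp u - 1) / Complex.exp u by
            field_simp; ring]
          field_simp
          ring
        rw [h1, div_neg]
        ring
      simp only [hodd]
      ring_nf
  unfold P
  rw [h.iteratedDeriv_eq, iteratedDeriv_comp_neg k (fun v : ℂ => Complex.exp (-z * lam v)) 0]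
  simp [mul_div_assoc]

theorem conj_lam (u : ℂ) : lam ((starRingEnd ℂ) u) = (starRingEnd ℂ) (lam u) := by
  unfold lam
  split_ifs with h1 h2 h2
  · simp
  · simp at h1; contradiction
  · simp [h2] at h1
  · simp [← Complex.exp_conj, map_ofNat]

theorem iteratedDeriv_conj_conj (k : ℕ) (f : ℂ → ℂ) :
    iteratedDeriv k ((starRingEnd ℂ) ∘ f ∘ (starRingEnd ℂ)) =
      (starRingEnd ℂ) ∘ iteratedDeriv k f ∘ (starRingEnd ℂ) := by
  induction k with
  | zero => simp
  | succ k ih => rw [iteratedDeriv_succ, ih, deriv_conj_conj, ← iteratedDeriv_succ]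

theorem conj_P (k : ℕ) (z : ℂ) : (starRingEnd ℂ) (P k z) = P k ((starRingEnd ℂ) z) := by
  unfold P
  have h : (fun u : ℂ => Complex.exp (-(starRingEnd ℂ) z * lam u)) =
      (starRingEnd ℂ) ∘ (fun u : ℂ => Complex.exp (-z * lam u)) ∘ (starRingEnd ℂ) := by
    ext u
    simp only [Function.comp, conj_lam]
    rw [← Complex.exp_conj]
    simp
  rw [h, iteratedDeriv_conj_conj]
  simp

theorem conj_eval_ascPochhammer (k : ℕ) (x : ℝ) :
    (starRingEnd ℂ) ((ascPochhammer ℂ k).eval (x : ℂ)) = (ascPochhammer ℂ k).eval (x : ℂ) := by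
  induction k with
  | zero => simp
  | succ k ih => rw [ascPochhammer_succ_eval]; simp [ih]

theorem conj_hankel (ν : ℝ) (j : ℕ) : (starRingEnd ℂ) (hankel ν j) = hankel ν j := by
  have h1 := conj_eval_ascPochhammer j (1 / 2 - ν)
  have h2 := conj_eval_ascPochhammer j (1 / 2 + ν)
  push_cast at h1 h2
  unfold hankel
  simp only [map_mul, h1, h2]
  simp

/-- `C̃_l` is real: `(2πi) ^ k P_k(2πi)` is invariant under conjugation since `λ` is odd and real
on the real axis. -/
theorem conj_Ctilde (l : ℕ) : (starRingEnd ℂ) (Ctilde l) = Ctilde l := by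
  unfold Ctilde
  rw [map_sum]
  refine Finset.sum_congr rfl fun p _ => ?_
  have h1 := conj_hankel (p.2 + 1) p.1
  push_cast at h1
  have hz : (starRingEnd ℂ) (2 * Real.pi * I : ℂ) = -(2 * Real.pi * I) := by
    simp [map_ofNat]
  rw [map_mul, map_mul, map_mul, h1, map_pow, conj_P, hz, P_neg, neg_pow]
  have : ((-1 : ℂ) ^ p.2) * (-1) ^ p.2 = 1 := by rw [← mul_pow]; simp
  have h2 : (starRingEnd ℂ) ((2 : ℂ) ^ (2 * p.1))⁻¹ = ((2 : ℂ) ^ (2 * p.1))⁻¹ := by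
    simp [map_ofNat]
  rw [h2]
  linear_combination (hankel (p.2 + 1) p.1 * (2 * Real.pi * I) ^ p.2 * P p.2 (2 * Real.pi * I) *
    ((2 : ℂ) ^ (2 * p.1))⁻¹) * this

/-! ### Expansion of the integral through the saddle point -/

/-- The direction `e ^ (iπ/4)` of the saddle point of `n u + 2πi / u`. -/
noncomputable def saddleDir : ℂ := Complex.exp (Real.pi / 4 * I)

/-- The modulus `√(2π / n)` of the saddle point of `n u + 2πi / u`. -/
noncomputable def saddleRadius (n : ℝ) : ℝ :=
  Real.exp ((Real.log (2 * Real.pi) - Real.log n) / 2)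

/-- The number `√(2πi n)`, which is half the value of `n u + 2πi / u` at its saddle point. -/
noncomputable def saddleArg (n : ℝ) : ℂ :=
  Complex.exp (((Real.log (2 * Real.pi) + Real.log n) / 2 : ℝ) + Real.pi / 4 * I)

theorem two_pi_pos : 0 < 2 * Real.pi := by positivity

theorem saddleDir_re : saddleDir.re = Real.sqrt 2 / 2 := by
  have := Complex.exp_ofReal_mul_I_re (Real.pi / 4)
  push_cast at this
  rw [saddleDir, this, Real.cos_pi_div_four]

theorem saddleDir_im : saddleDir.im = Real.sqrt 2 / 2 := by
  have := Complex.exp_ofReal_mul_I_im (Real.pi / 4)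
  push_cast at this
  rw [saddleDir, this, Real.sin_pi_div_four]

theorem norm_saddleDir : ‖saddleDir‖ = 1 := by
  have := Complex.norm_exp_ofReal_mul_I (Real.pi / 4)
  push_cast at this
  exact this

theorem saddleRadius_pos (n : ℝ) : 0 < saddleRadius n := Real.exp_pos _

theorem saddleRadius_eq {n : ℝ} (hn : 0 < n) :
    saddleRadius n = Real.sqrt (2 * Real.pi) * Real.sqrt n ^ (-1 : ℝ) := by
  rw [Real.sqrt_eq_rpow, Real.sqrt_eq_rpow, ← Real.rpow_mul hn.le,
    Real.rpow_def_of_pos two_pi_pos, Real.rpow_def_of_pos hn, ← Real.exp_add, saddleRadius]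
  congr 1; ring

theorem saddleArg_re {n : ℝ} (hn : 0 < n) : (saddleArg n).re = Real.sqrt (Real.pi * n) := by
  have h2 : Real.exp ((Real.log (2 * Real.pi) + Real.log n) / 2) = Real.sqrt (2 * Real.pi * n) := by
    rw [← Real.log_mul two_pi_pos.ne' hn.ne', Real.sqrt_eq_rpow,
      Real.rpow_def_of_pos (mul_pos two_pi_pos hn)]
    congr 1; ring
  have h := saddleDir_re
  rw [saddleDir] at h
  rw [saddleArg, Complex.exp_add, ← ofReal_exp, re_ofReal_mul, h, h2, mul_assoc,
    Real.sqrt_mul zero_le_two]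
  have := Real.mul_self_sqrt (zero_le_two (α := ℝ))
  linear_combination Real.sqrt (Real.pi * n) / 2 * this

theorem saddleArg_im {n : ℝ} (hn : 0 < n) : (saddleArg n).im = Real.sqrt (Real.pi * n) := by
  rw [← saddleArg_re hn]
  have h := saddleDir_re
  have h' := saddleDir_im
  rw [saddleDir] at h h'
  rw [saddleArg, Complex.exp_add, ← ofReal_exp, re_ofReal_mul, im_ofReal_mul, h, h']

/-- The phase identity that turns the product of a power of the saddle point and a power of
`1 / √(2πi n)` into a power of `n` that depends on `j + k` only. -/
theorem saddle_pow_mul {n : ℝ} (hn : 0 < n) (j k : ℕ) :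
    (saddleDir * saddleRadius n) ^ (k + 1) * saddleArg n ^ (-(j + 1 / 2) : ℂ) =
      (2 * Real.pi * I) ^ k *
        (Complex.exp ((Real.log (2 * Real.pi) / 2 + Real.pi / 4 * I) * (1 / 2 - (j + k : ℕ))) *
          ((n ^ (-((j + k : ℕ) : ℝ) / 2 - 3 / 4) : ℝ) : ℂ)) := by
  have h1 : saddleArg n ^ (-(j + 1 / 2) : ℂ) =
      Complex.exp ((((Real.log (2 * Real.pi) + Real.log n) / 2 : ℝ) + Real.pi / 4 * I) *
        (-(j + 1 / 2))) := by
    rw [saddleArg, cpow_def_of_ne_zero (Complex.exp_ne_zero _), Complex.log_exp]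
    · simp; linarith [Real.pi_pos]
    · simp; linarith [Real.pi_pos]
  have h2 : (2 * Real.pi * I : ℂ) = Complex.exp (Real.log (2 * Real.pi) + Real.pi / 2 * I) := by
    rw [Complex.exp_add, ← ofReal_exp, Real.exp_log two_pi_pos, Complex.exp_pi_div_two_mul_I]
    push_cast; ring
  rw [h1, h2, Real.rpow_def_of_pos hn, saddleDir, saddleRadius, ofReal_exp, ofReal_exp,
    ← Complex.exp_add, ← Complex.exp_nat_mul, ← Complex.exp_nat_mul, ← Complex.exp_add,
    ← Complex.exp_add, ← Complex.exp_add]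
  congr 1
  push_cast
  ring

/-- The integral of `e ^ (-n u - 2πi / u) e ^ (-2πi λ(u))` along the ray of direction `e ^ (iπ/4)`,
parametrized by `u = √(2πi / n) e ^ θ`. -/
noncomputable def saddleIntegral (n : ℝ) : ℂ :=
  ∫ θ : ℝ, saddleDir * (saddleRadius n * Real.exp θ : ℝ) *
    Complex.exp (-(2 * saddleArg n * Real.cosh θ)) *
    Complex.exp (-(2 * Real.pi * I) * lam (saddleDir * (saddleRadius n * Real.exp θ : ℝ)))

/-- The leading-order bound for `2 K_ν(β)`, `β ≥ 2`, which controls the Taylor remainder. -/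
theorem integral_exp_mul_exp_neg_cosh_le (ν : ℕ) (hν : 0 < ν) : ∃ K : ℝ, 0 ≤ K ∧ ∀ β : ℝ, 2 ≤ β →
    ∫ θ : ℝ, Real.exp (ν * θ) * Real.exp (-(β * Real.cosh θ)) ≤
      K * (Real.exp (-β) * (β / 2) ^ (-(1 / 2) : ℝ)) := by
  obtain ⟨K, hK, h⟩ := bessel_expansion ν hν 0
  refine ⟨K, hK, fun β hβ => ?_⟩
  have := h β (by simpa using hβ)
  simp only [Finset.range_zero, Finset.sum_empty, mul_zero, sub_zero, ofReal_re, Nat.cast_zero,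
    zero_add] at this
  refine le_trans ?_ this
  have e : ∫ θ : ℝ, Complex.exp (ν * θ) * Complex.exp (-(β * Real.cosh θ)) =
      ((∫ θ : ℝ, Real.exp (ν * θ) * Real.exp (-(β * Real.cosh θ)) : ℝ) : ℂ) := by
    rw [← integral_complex_ofReal]
    push_cast
    rfl
  rw [e, norm_real]
  exact le_abs_self _

theorem norm_exp_mul_exp_neg_cosh (ν : ℝ) (z : ℂ) (θ : ℝ) :
    ‖Complex.exp (ν * θ) * Complex.exp (-(z * Real.cosh θ))‖ =
      Real.exp (ν * θ) * Real.exp (-(z.re * Real.cosh θ)) := by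
  rw [norm_mul, Complex.norm_exp, Complex.norm_exp, neg_re, re_mul_ofReal, re_mul_ofReal, ofReal_re]

/-- The asymptotic expansion of the saddle point integral. -/
theorem saddleIntegral_expansion (L : ℕ) : ∃ K : ℝ, ∀ n : ℝ, 1 ≤ n →
    ‖saddleIntegral n - Complex.exp (-(2 * saddleArg n)) * Real.sqrt Real.pi *
      ∑ l ∈ Finset.range (L + 1), Ctilde l *
        (Complex.exp ((Real.log (2 * Real.pi) / 2 + Real.pi / 4 * I) * (1 / 2 - l)) *
          ((n ^ (-(l : ℝ) / 2 - 3 / 4) : ℝ) : ℂ))‖ ≤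
    K * (n ^ (-(L : ℝ) / 2 - 5 / 4) * Real.exp (-2 * Real.sqrt (Real.pi * n))) := by
  obtain ⟨C, hC, hg⟩ := hasExpansion_exp_lam (2 * Real.pi * I) (ω := saddleDir)
    (by rw [saddleDir_re]; positivity)
    (by rw [saddleDir_re, saddleDir_im, abs_of_nonneg (by positivity)]) (L + 1)
  simp only [pow_zero, mul_one] at hg
  obtain ⟨K0, hK0, hrem⟩ := integral_exp_mul_exp_neg_cosh_le (L + 2) (by lia)
  choose K hK hbes using fun k : ℕ => bessel_expansion (k + 1) k.succ_pos (L + 1 - k)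
  set z0 : ℂ := 2 * Real.pi * I with hz0
  set s2 : ℝ := Real.sqrt (2 * Real.pi)
  set s1 : ℝ := Real.sqrt Real.pi with hs1
  have hs1pos : 0 < s1 := Real.sqrt_pos.2 Real.pi_pos
  have hs1one : 1 ≤ s1 := Real.one_le_sqrt.2 (by linarith [Real.pi_gt_three])
  refine ⟨∑ k ∈ Finset.range (L + 1),
      ‖P k z0‖ * (s2 ^ (k + 1) * (K k * s1 ^ (-((L + 1 - k : ℕ) + 1 / 2) : ℝ))) +
    C * (s2 ^ (L + 2) * (K0 * s1 ^ (-(1 / 2) : ℝ))), fun n hn => ?_⟩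
  have hn0 : 0 < n := by linarith
  set q : ℝ := Real.sqrt n with hq
  have hqpos : 0 < q := Real.sqrt_pos.2 hn0
  have hq1 : 1 ≤ q := Real.one_le_sqrt.2 hn
  set W := saddleArg n with hW
  set R := saddleRadius n with hR
  have hRpos : 0 < R := saddleRadius_pos n
  have hReq : R = s2 * q ^ (-1 : ℝ) := saddleRadius_eq hn0
  have hWre : W.re = s1 * q := by
    rw [hW, saddleArg_re hn0, Real.sqrt_mul Real.pi_pos.le]
  have hzre : (2 * W).re = 2 * (s1 * q) := by simp [hWre]
  have hz2 : 2 ≤ (2 * W).re := by rw [hzre]; nlinarith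
  have hzpos : 0 < (2 * W).re := by linarith
  have hexp : -(2 * W).re = -2 * Real.sqrt (Real.pi * n) := by
    rw [hzre, Real.sqrt_mul Real.pi_pos.le]; ring
  have htarget : n ^ (-(L : ℝ) / 2 - 5 / 4) = q ^ (-((L : ℝ) + 5 / 2)) := by
    rw [hq, Real.sqrt_eq_rpow, ← Real.rpow_mul hn0.le]; congr 1; ring
  have hRpow : ∀ i : ℕ, R ^ i = s2 ^ i * q ^ (-(i : ℝ)) := by
    intro i
    rw [hReq, mul_pow, ← Real.rpow_natCast (q ^ (-1 : ℝ)), ← Real.rpow_mul hqpos.le]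
    congr 2; ring
  let B : ℕ → ℂ := fun k => ∫ θ : ℝ, Complex.exp ((k + 1 : ℕ) * θ) *
    Complex.exp (-(2 * W * Real.cosh θ))
  have hBint : ∀ k : ℕ, Integrable fun θ : ℝ => Complex.exp ((k + 1 : ℕ) * θ) *
      Complex.exp (-(2 * W * Real.cosh θ)) := by
    intro k
    have := integrable_exp_mul_exp_neg_cosh (ν := ((k + 1 : ℕ) : ℝ)) (by positivity) hzpos
    simpa only [ofReal_natCast] using this
  let g : ℝ → ℂ := fun θ => Complex.exp (-z0 * lam (saddleDir * (R * Real.exp θ : ℝ)))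
  let T : ℝ → ℂ := fun θ => ∑ k ∈ Finset.range (L + 1), P k z0 * saddleDir ^ k *
    ((R * Real.exp θ : ℝ) : ℂ) ^ k
  let w : ℝ → ℂ := fun θ => saddleDir * (R * Real.exp θ : ℝ) *
    Complex.exp (-(2 * W * Real.cosh θ))
  have hwT : ∀ θ, w θ * T θ = ∑ k ∈ Finset.range (L + 1), P k z0 * (saddleDir * R) ^ (k + 1) *
      (Complex.exp ((k + 1 : ℕ) * θ) * Complex.exp (-(2 * W * Real.cosh θ))) := by
    intro θ
    simp only [w, T, Finset.mul_sum]
    refine Finset.sum_congr rfl fun k _ => ?_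
    rw [Complex.exp_nat_mul]
    push_cast
    ring
  have hwTint : Integrable fun θ => w θ * T θ := by
    simp_rw [hwT]
    exact integrable_finsetSum _ fun k _ => (hBint k).const_mul _
  have hRint : Integrable fun θ : ℝ => Real.exp (((L + 2 : ℕ) : ℝ) * θ) *
      Real.exp (-((2 * W).re * Real.cosh θ)) := by
    have := (hBint (L + 1)).norm
    refine this.congr (Eventually.of_forall fun θ => ?_)
    have e := norm_exp_mul_exp_neg_cosh ((L + 2 : ℕ) : ℝ) (2 * W) θ
    rw [ofReal_natCast] at e
    exact e
  have hdiff : ∀ θ, ‖w θ * g θ - w θ * T θ‖ ≤ C * R ^ (L + 2) *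
      (Real.exp (((L + 2 : ℕ) : ℝ) * θ) * Real.exp (-((2 * W).re * Real.cosh θ))) := by
    intro θ
    have hx : 0 < R * Real.exp θ := by positivity
    have h1 := hg _ hx
    have h2 : ‖w θ‖ = R * Real.exp θ * Real.exp (-((2 * W).re * Real.cosh θ)) := by
      simp only [w]
      rw [norm_mul, norm_mul, norm_saddleDir, one_mul, norm_real, Real.norm_of_nonneg hx.le,
        Complex.norm_exp, neg_re, re_mul_ofReal]
    rw [← mul_sub, norm_mul, h2]
    calc _ ≤ R * Real.exp θ * Real.exp (-((2 * W).re * Real.cosh θ)) *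
          (C * (R * Real.exp θ) ^ (L + 1)) := by gcongr
      _ = _ := by rw [Real.exp_nat_mul]; ring
  have hgmeas : AEStronglyMeasurable (fun θ => w θ * g θ) volume := by
    have hlam : Continuous fun θ : ℝ => lam (saddleDir * (R * Real.exp θ : ℝ)) := by
      have e : ∀ θ : ℝ, 0 < (saddleDir * (R * Real.exp θ : ℝ)).re := by
        intro θ
        rw [re_mul_ofReal, saddleDir_re]; positivity
      have hne : ∀ θ : ℝ, saddleDir * (R * Real.exp θ : ℝ) ≠ 0 := by
        intro θ h
        have := e θ
        rw [h] at this
        simp at this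
      have hne2 := fun θ : ℝ => exp_sub_one_ne_zero_of_re_ne_zero (e θ).ne'
      simp_rw [fun θ : ℝ => lam_of_ne (hne θ)]
      fun_prop (disch := first | exact hne _ | exact hne2 _)
    refine Continuous.aestronglyMeasurable ?_
    simp only [w, g]
    fun_prop
  have hdint : Integrable fun θ => w θ * g θ - w θ * T θ :=
    (hRint.const_mul _).mono' (hgmeas.sub hwTint.aestronglyMeasurable)
      (Eventually.of_forall hdiff)
  have hsplit : saddleIntegral n = ∑ k ∈ Finset.range (L + 1),
      P k z0 * (saddleDir * R) ^ (k + 1) * B k + ∫ θ, (w θ * g θ - w θ * T θ) := by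
    have e1 : ∑ k ∈ Finset.range (L + 1), P k z0 * (saddleDir * R) ^ (k + 1) * B k =
        ∫ θ, w θ * T θ := by
      simp_rw [hwT]
      rw [integral_finsetSum _ fun k _ => (hBint k).const_mul _]
      exact Finset.sum_congr rfl fun k _ => (integral_const_mul _ _).symm
    rw [e1, ← integral_add hwTint hdint]
    refine integral_congr_ae (Eventually.of_forall fun θ => ?_)
    simp only [w, g]
    ring
  let S : ℕ → ℂ := fun k => Complex.exp (-(2 * W)) * ∑ j ∈ Finset.range (L + 1 - k),
    ((s1 : ℂ) * hankel ((k + 1 : ℕ) : ℂ) j / 4 ^ j) * W ^ (-(j + 1 / 2) : ℂ)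
  -- the double sum over `k` and `j < L + 1 - k` regroups along the antidiagonals `j + k = l`
  have hmain : Complex.exp (-(2 * W)) * s1 * ∑ l ∈ Finset.range (L + 1), Ctilde l *
        (Complex.exp ((Real.log (2 * Real.pi) / 2 + Real.pi / 4 * I) * (1 / 2 - l)) *
          ((n ^ (-(l : ℝ) / 2 - 3 / 4) : ℝ) : ℂ)) =
      ∑ k ∈ Finset.range (L + 1), P k z0 * (saddleDir * R) ^ (k + 1) * S k := by
    let F : ℕ → ℕ → ℂ := fun k j => Complex.exp (-(2 * W)) * s1 *
      (P k z0 * hankel ((k + 1 : ℕ) : ℂ) j / 4 ^ j *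
        ((saddleDir * R) ^ (k + 1) * W ^ (-(j + 1 / 2) : ℂ)))
    have e1 : ∀ k, P k z0 * (saddleDir * R) ^ (k + 1) * S k =
        ∑ j ∈ Finset.range (L + 1 - k), F k j := by
      intro k
      simp only [S, F, Finset.mul_sum]
      exact Finset.sum_congr rfl fun j _ => by ring
    simp_rw [e1]
    rw [← Finset.sum_range_diag_flip, Finset.mul_sum]
    refine Finset.sum_congr rfl fun l _ => ?_
    rw [← Finset.Nat.sum_antidiagonal_eq_sum_range_succ F, Ctilde,
      ← Finset.Nat.sum_antidiagonal_swap, Finset.sum_mul, Finset.mul_sum]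
    refine Finset.sum_congr rfl fun p hp => ?_
    have hpl : p.2 + p.1 = l := by rw [add_comm]; exact Finset.HasAntidiagonal.mem_antidiagonal.1 hp
    simp only [F, Prod.fst_swap, Prod.snd_swap]
    rw [saddle_pow_mul hn0, hpl, pow_mul, ← hz0, show (2 : ℂ) ^ 2 = 4 by norm_num]
    push_cast
    ring
  rw [hmain, hsplit, add_sub_right_comm, ← Finset.sum_sub_distrib, add_mul, ← hexp, htarget]
  refine (norm_add_le _ _).trans (add_le_add ?_ ?_)
  · refine (norm_sum_le _ _).trans ?_
    rw [Finset.sum_mul]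
    refine Finset.sum_le_sum fun k hk => ?_
    have hkL : k ≤ L := by have := Finset.mem_range.1 hk; lia
    have hb := hbes k (2 * W) hz2
    rw [← mul_sub, norm_mul, norm_mul, norm_pow, norm_mul, norm_saddleDir, one_mul, norm_real,
      Real.norm_of_nonneg hRpos.le, hRpow]
    have hb' : ‖B k - S k‖ ≤ K k * (Real.exp (-(2 * W).re) *
        (s1 ^ (-((L + 1 - k : ℕ) + 1 / 2) : ℝ) * q ^ (-((L + 1 - k : ℕ) + 1 / 2) : ℝ))) := by
      rw [hzre, mul_div_cancel_left₀ _ two_ne_zero, mul_div_cancel_left₀ _ (two_ne_zero (α := ℝ)),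
        Real.mul_rpow hs1pos.le hqpos.le, ← hzre] at hb
      exact hb
    have hqq : q ^ (-((k + 1 : ℕ) : ℝ)) * q ^ (-((L + 1 - k : ℕ) + 1 / 2) : ℝ) =
        q ^ (-((L : ℝ) + 5 / 2)) := by
      rw [← Real.rpow_add hqpos, Nat.cast_sub (by lia)]
      congr 1
      push_cast
      ring
    calc _ ≤ ‖P k z0‖ * (s2 ^ (k + 1) * q ^ (-((k + 1 : ℕ) : ℝ))) *
          (K k * (Real.exp (-(2 * W).re) *
        (s1 ^ (-((L + 1 - k : ℕ) + 1 / 2) : ℝ) * q ^ (-((L + 1 - k : ℕ) + 1 / 2) : ℝ)))) := by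
          gcongr
      _ = _ := by rw [← hqq]; ring
  · have h1 := norm_integral_le_of_norm_le (hRint.const_mul (C * R ^ (L + 2)))
      (Eventually.of_forall hdiff)
    rw [integral_const_mul] at h1
    have h2 := hrem _ hz2
    rw [hzre, mul_div_cancel_left₀ _ (two_ne_zero (α := ℝ)), Real.mul_rpow hs1pos.le hqpos.le,
      ← hzre] at h2
    have hqq : q ^ (-((L + 2 : ℕ) : ℝ)) * q ^ (-(1 / 2) : ℝ) = q ^ (-((L : ℝ) + 5 / 2)) := by
      rw [← Real.rpow_add hqpos]
      congr 1
      push_cast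
      ring
    calc _ ≤ _ := h1
      _ ≤ C * R ^ (L + 2) * (K0 * (Real.exp (-(2 * W).re) *
          (s1 ^ (-(1 / 2) : ℝ) * q ^ (-(1 / 2) : ℝ)))) := by gcongr
      _ = _ := by rw [hRpow, ← hqq]; ring

/-! ### Rotation of the path of integration -/

/-- The integral `∫₀¹ y ^ (n - 1) e ^ (-z y / (1 - y)) dy`, whose Mellin transform in the scale of
`z` is a product of Gamma functions. -/
noncomputable def eulerIntegral (n : ℕ) (z : ℂ) : ℂ :=
  ∫ y : ℝ in Ioo 0 1, (y : ℂ) ^ (n - 1) * Complex.exp (-(z * (y / (1 - y) : ℝ)))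

/-- The integrand of `eulerIntegral n (2πi)` in the variable `y = exp (-exp w)`. -/
noncomputable def logIntegrand (n : ℕ) (w : ℂ) : ℂ :=
  Complex.exp w * Complex.exp (-(n * Complex.exp w)) *
    Complex.exp (-(2 * Real.pi * I / (Complex.exp (Complex.exp w) - 1)))

theorem eulerIntegral_eq_integral_logIntegrand {n : ℕ} (hn : 1 ≤ n) :
    eulerIntegral n (2 * Real.pi * I) = ∫ a : ℝ, logIntegrand n a := by
  have himg : (fun a : ℝ => Real.exp (-Real.exp a)) '' univ = Ioo 0 1 := by
    ext y
    constructor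
    · rintro ⟨a, -, rfl⟩
      exact ⟨Real.exp_pos _, Real.exp_lt_one_iff.2 (by simpa using Real.exp_pos a)⟩
    · rintro ⟨h0, h1⟩
      refine ⟨Real.log (-Real.log y), mem_univ _, ?_⟩
      have := Real.log_neg h0 h1
      simp only
      rw [Real.exp_log (by linarith), neg_neg, Real.exp_log h0]
  have hinj : InjOn (fun a : ℝ => Real.exp (-Real.exp a)) univ := by
    intro a _ b _ h
    simpa using h
  have hcov := integral_image_eq_integral_abs_deriv_smul (s := univ)
    (f := fun a : ℝ => Real.exp (-Real.exp a))
    (f' := fun a => Real.exp (-Real.exp a) * -Real.exp a) MeasurableSet.univ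
    (fun a _ => ((Real.hasDerivAt_exp a).neg.exp).hasDerivWithinAt) hinj
    (fun y : ℝ => (y : ℂ) ^ (n - 1) * Complex.exp (-(2 * Real.pi * I * (y / (1 - y) : ℝ))))
  rw [himg] at hcov
  rw [eulerIntegral, hcov, setIntegral_univ]
  refine integral_congr_ae (Eventually.of_forall fun a => ?_)
  have he : 0 < Real.exp a := Real.exp_pos a
  have h1 : 0 < Real.exp (Real.exp a) - 1 := by
    have := Real.add_one_lt_exp he.ne'
    linarith
  have hfrac : Real.exp (-Real.exp a) / (1 - Real.exp (-Real.exp a)) =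
      1 / (Real.exp (Real.exp a) - 1) := by
    rw [Real.exp_neg]
    have := Real.exp_pos (Real.exp a)
    have h2 : 1 - (Real.exp (Real.exp a))⁻¹ = (Real.exp (Real.exp a) - 1) / Real.exp (Real.exp a) := by
      field_simp
    rw [h2]
    field_simp
  simp only [logIntegrand]
  rw [hfrac, mul_neg, abs_neg, abs_of_pos (by positivity), real_smul]
  obtain ⟨m, rfl⟩ : ∃ m, n = m + 1 := ⟨n - 1, by lia⟩
  have e1 : Complex.exp (-(((m + 1 : ℕ) : ℂ) * Complex.exp a)) =
      Complex.exp (-Complex.exp a) ^ (m + 1) := by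
    rw [← Complex.exp_nat_mul]; congr 1; ring
  rw [e1, add_tsub_cancel_right]
  push_cast
  rw [mul_one_div]
  ring

/-- The minus sign is `e ^ (πi)`, from the constant `1/2` in `λ`. -/
theorem exp_neg_two_pi_I_div_exp_sub_one {u : ℂ} (hu : u ≠ 0) :
    Complex.exp (-(2 * Real.pi * I / (Complex.exp u - 1))) =
      -(Complex.exp (-(2 * Real.pi * I / u)) * Complex.exp (-(2 * Real.pi * I) * lam u)) := by
  have h : -(2 * Real.pi * I / (Complex.exp u - 1)) =
      -(2 * Real.pi * I / u) + -(2 * Real.pi * I) * lam u + Real.pi * I := by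
    rw [lam_of_ne hu]; ring
  rw [h, Complex.exp_add, Complex.exp_add, Complex.exp_pi_mul_I]
  ring

/-- Throughout the strip `0 ≤ Im w ≤ π / 4` the point `u = e ^ w` has `Re (i / u) ≥ 0`, so that the
factor `e ^ (-2πi / u)` stays bounded although it oscillates without decay on the real axis. -/
theorem integral_logIntegrand_shift {n : ℕ} (hn : 1 ≤ n) :
    ∫ a : ℝ, logIntegrand n (a + (Real.pi / 4 : ℝ) * I) = ∫ a : ℝ, logIntegrand n a := by
  obtain ⟨M, hM, hlam⟩ := exists_lam_bound
  have hn0 : (0 : ℝ) < n := by exact_mod_cast hn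
  have hpi := Real.pi_pos
  have hmem : ∀ w : ℂ, w.im ∈ uIcc 0 (Real.pi / 4) →
      0 ≤ (Complex.exp w).im ∧ (Complex.exp w).im ≤ (Complex.exp w).re ∧
        Real.exp w.re / 2 ≤ (Complex.exp w).re := by
    intro w hw
    rw [uIcc_of_le (by positivity)] at hw
    have hc : Real.sqrt 2 / 2 ≤ Real.cos w.im := by
      rw [← Real.cos_pi_div_four]
      exact Real.cos_le_cos_of_nonneg_of_le_pi hw.1 (by linarith) hw.2
    have hs : Real.sin w.im ≤ Real.sqrt 2 / 2 := by
      rw [← Real.sin_pi_div_four]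
      exact Real.sin_le_sin_of_le_of_le_pi_div_two (by linarith [hw.1]) (by linarith) hw.2
    have hs0 : 0 ≤ Real.sin w.im := Real.sin_nonneg_of_nonneg_of_le_pi hw.1 (by linarith [hw.2])
    have h2 : 1 ≤ Real.sqrt 2 := Real.one_le_sqrt.2 (by norm_num)
    have he := Real.exp_pos w.re
    rw [exp_re, exp_im]
    refine ⟨by positivity, ?_, ?_⟩
    · gcongr; linarith
    · nlinarith
  have hpos : ∀ w : ℂ, w.im ∈ uIcc 0 (Real.pi / 4) → 0 < (Complex.exp w).re := by
    intro w hw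
    have := (hmem w hw).2.2
    have := Real.exp_pos w.re
    linarith
  refine integral_strip_shift (B := fun a => Real.exp (2 * Real.pi * M) *
    (Real.exp (1 * a) * Real.exp (-(n / 2 * Real.exp a)))) ?_ ?_ ?_ ?_ ?_
  · intro w hw
    refine DifferentiableAt.differentiableWithinAt ?_
    have hne := exp_sub_one_ne_zero_of_re_ne_zero (hpos w hw).ne'
    unfold logIntegrand
    fun_prop (disch := assumption)
  · intro w hw
    obtain ⟨him, hle, hhalf⟩ := hmem w hw
    set u := Complex.exp w with hu
    have hu0 : u ≠ 0 := Complex.exp_ne_zero w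
    rw [logIntegrand, ← hu, exp_neg_two_pi_I_div_exp_sub_one hu0]
    have h1 : ‖u‖ = Real.exp (1 * w.re) := by rw [hu, Complex.norm_exp, one_mul]
    have h2 : ‖Complex.exp (-(n * u))‖ ≤ Real.exp (-(n / 2 * Real.exp w.re)) := by
      rw [Complex.norm_exp, Real.exp_le_exp, neg_re, ← ofReal_natCast, re_ofReal_mul]
      nlinarith
    have h3 : ‖Complex.exp (-(2 * Real.pi * I / u))‖ ≤ 1 := by
      rw [Complex.norm_exp, Real.exp_le_one_iff, neg_re, div_eq_mul_inv]
      have e : (2 * Real.pi * I * u⁻¹).re = 2 * Real.pi * (u.im / normSq u) := by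
        have : (2 * Real.pi * I * u⁻¹ : ℂ) = ((2 * Real.pi : ℝ) : ℂ) * (I * u⁻¹) := by
          push_cast; ring
        rw [this, re_ofReal_mul, I_mul_re, inv_im]
        ring
      rw [e]
      have : 0 ≤ normSq u := normSq_nonneg u
      have h4 : 0 ≤ 2 * Real.pi * (u.im / normSq u) := by positivity
      linarith
    have h4 : ‖Complex.exp (-(2 * Real.pi * I) * lam u)‖ ≤ Real.exp (2 * Real.pi * M) := by
      refine (Complex.norm_exp_le_exp_norm _).trans ?_
      have h5 := hlam u (hpos w hw) (by rwa [abs_of_nonneg him])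
      have h6 : ‖-(2 * Real.pi * I : ℂ)‖ = 2 * Real.pi := by
        simp [abs_of_pos hpi]
      rw [norm_mul, h6]
      gcongr
    rw [norm_mul, norm_mul, norm_neg, norm_mul, h1]
    calc _ ≤ Real.exp (1 * w.re) * Real.exp (-(n / 2 * Real.exp w.re)) *
          (1 * Real.exp (2 * Real.pi * M)) := by gcongr
      _ = _ := by ring
  · exact (integrable_exp_mul_exp_neg_exp one_pos (half_pos hn0)).const_mul _
  · simpa using (tendsto_exp_mul_exp_neg_exp_atTop 1 (half_pos hn0)).const_mul
      (Real.exp (2 * Real.pi * M))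
  · simpa using (tendsto_exp_mul_exp_neg_exp_atBot one_pos (half_pos hn0)).const_mul
      (Real.exp (2 * Real.pi * M))

theorem mul_saddleDir_mul_saddleRadius {n : ℝ} (hn : 0 < n) :
    n * (saddleDir * saddleRadius n) = saddleArg n := by
  have h : (n : ℂ) = Complex.exp (Real.log n) := by rw [← ofReal_exp, Real.exp_log hn]
  rw [h, saddleDir, saddleRadius, saddleArg, ofReal_exp, ← Complex.exp_add, ← Complex.exp_add]
  congr 1
  push_cast
  ring

theorem two_pi_I_div_saddleDir_mul_saddleRadius (n : ℝ) :
    2 * Real.pi * I / (saddleDir * saddleRadius n) = saddleArg n := by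
  have h2 : (2 * Real.pi * I : ℂ) = Complex.exp (Real.log (2 * Real.pi) + Real.pi / 2 * I) := by
    rw [Complex.exp_add, ← ofReal_exp, Real.exp_log two_pi_pos, Complex.exp_pi_div_two_mul_I]
    push_cast; ring
  rw [h2, saddleDir, saddleRadius, saddleArg, ofReal_exp, ← Complex.exp_add, ← Complex.exp_sub]
  congr 1
  push_cast
  ring

/-- Rotation of the path of integration to the ray through the saddle point. -/
theorem eulerIntegral_two_pi_I {n : ℕ} (hn : 1 ≤ n) :
    eulerIntegral n (2 * Real.pi * I) = -saddleIntegral n := by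
  have hn0 : (0 : ℝ) < n := by exact_mod_cast hn
  set ρ : ℝ := (Real.log (2 * Real.pi) - Real.log n) / 2 with hρ
  rw [eulerIntegral_eq_integral_logIntegrand hn, ← integral_logIntegrand_shift hn,
    ← integral_add_right_eq_self (fun a : ℝ => logIntegrand n (a + (Real.pi / 4 : ℝ) * I)) ρ,
    saddleIntegral, ← integral_neg]
  refine integral_congr_ae (Eventually.of_forall fun θ => ?_)
  set u : ℂ := saddleDir * (saddleRadius n * Real.exp θ : ℝ) with hu
  have hexp : Complex.exp (((θ + ρ : ℝ) : ℂ) + (Real.pi / 4 : ℝ) * I) = u := by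
    rw [hu, saddleDir, saddleRadius, ← hρ, ← Real.exp_add, ofReal_exp, ← Complex.exp_add]
    congr 1
    push_cast
    ring
  have hu0 : u ≠ 0 := hexp ▸ Complex.exp_ne_zero _
  have hcosh : (n : ℂ) * u + 2 * Real.pi * I / u = 2 * saddleArg n * Real.cosh θ := by
    have e1 := mul_saddleDir_mul_saddleRadius hn0
    have e2 := two_pi_I_div_saddleDir_mul_saddleRadius n
    rw [ofReal_natCast] at e1
    have e3 : u = saddleDir * saddleRadius n * Complex.exp θ := by rw [hu]; push_cast; ring
    rw [e3, ← div_div, e2, ← mul_assoc, e1, Real.cosh_eq]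
    push_cast
    rw [Complex.exp_neg]
    ring
  simp only [logIntegrand]
  rw [hexp, exp_neg_two_pi_I_div_exp_sub_one hu0, ← hcosh, neg_add, Complex.exp_add]
  ring

/-! ### The Mellin-Barnes integrand on the line `Re s = 3/2` -/

theorem norm_Gamma_le {s : ℂ} (hs : 0 < s.re) : ‖Gamma s‖ ≤ Real.Gamma s.re := by
  rw [Gamma_eq_integral hs, GammaIntegral, Real.Gamma_eq_integral hs]
  refine norm_integral_le_of_norm_le (Real.GammaIntegral_convergent hs) ?_
  filter_upwards [ae_restrict_mem measurableSet_Ioi] with x hx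
  rw [norm_mul, norm_real, norm_cpow_eq_rpow_re_of_pos hx, sub_re, one_re,
    Real.norm_of_nonneg (Real.exp_pos _).le]

/-- The point of height `t` on the line `Re s = 3/2`. -/
noncomputable def linePoint (t : ℝ) : ℂ := 3 / 2 + t * I

theorem linePoint_re (t : ℝ) : (linePoint t).re = 3 / 2 := by simp [linePoint]

theorem linePoint_im (t : ℝ) : (linePoint t).im = t := by simp [linePoint]

/-- Euler's reflection formula on the line `Re s = 3/2`. -/
theorem norm_Gamma_mul_Gamma_one_sub_linePoint (t : ℝ) :
    ‖Gamma (linePoint t) * Gamma (1 - linePoint t)‖ = Real.pi / Real.cosh (Real.pi * t) := by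
  have h : Complex.sin (Real.pi * linePoint t) = -(Real.cosh (Real.pi * t) : ℂ) := by
    have e : Real.pi * linePoint t = (Real.pi * t : ℝ) * I + Real.pi / 2 + Real.pi := by
      rw [linePoint]; push_cast; ring
    rw [e, Complex.sin_add_pi, Complex.sin_add_pi_div_two, Complex.cos_mul_I, ofReal_cosh]
  rw [Complex.Gamma_mul_Gamma_one_sub, h, norm_div, norm_neg, norm_real, norm_real,
    Real.norm_of_nonneg Real.pi_pos.le, Real.norm_of_nonneg (Real.cosh_pos _).le]

theorem norm_Gamma_nat_sub_linePoint_le (n : ℕ) (t : ℝ) :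
    ‖Gamma (((n + 1 : ℕ) : ℂ) - linePoint t)‖ ≤
      (n + 2 + |t|) ^ n * ‖Gamma (1 - linePoint t)‖ := by
  induction n with
  | zero => simp
  | succ n ih =>
    have hne : ((n + 1 : ℕ) : ℂ) - linePoint t ≠ 0 := by
      intro h
      have h1 := congrArg re h
      rw [sub_re, linePoint_re, natCast_re, zero_re] at h1
      have h2 : (((n + 1) * 2 : ℕ) : ℝ) = (3 : ℕ) := by push_cast at h1 ⊢; linarith
      have h3 : (n + 1) * 2 = 3 := by exact_mod_cast h2
      lia
    have e : (((n + 1 + 1 : ℕ) : ℂ) - linePoint t) = ((n + 1 : ℕ) : ℂ) - linePoint t + 1 := by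
      push_cast; ring
    have hnorm : ‖((n + 1 : ℕ) : ℂ) - linePoint t‖ ≤ (n + 1 : ℕ) + 2 + |t| := by
      refine (Complex.norm_le_abs_re_add_abs_im _).trans ?_
      rw [sub_re, sub_im, linePoint_re, linePoint_im, natCast_re, natCast_im, zero_sub, abs_neg]
      have hn : (0 : ℝ) ≤ n := n.cast_nonneg
      gcongr
      rw [abs_le]
      push_cast
      constructor <;> linarith
    rw [e, Gamma_add_one _ hne, norm_mul, pow_succ']
    have hle : (n + 2 + |t|) ^ n ≤ ((n + 1 : ℕ) + 2 + |t|) ^ n := by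
      gcongr; lia
    calc _ ≤ ((n + 1 : ℕ) + 2 + |t|) * ((n + 2 + |t|) ^ n * ‖Gamma (1 - linePoint t)‖) := by gcongr
      _ ≤ ((n + 1 : ℕ) + 2 + |t|) * (((n + 1 : ℕ) + 2 + |t|) ^ n * ‖Gamma (1 - linePoint t)‖) := by
        gcongr
      _ = _ := by ring

/-- The integrand `Γ(s) Γ(s + 1) Γ(n - s) z ^ (-s)` on the line `Re s = 3/2`. -/
noncomputable def barnesIntegrand (n : ℕ) (z : ℂ) (t : ℝ) : ℂ :=
  Gamma (linePoint t) * Gamma (linePoint t + 1) * Gamma (n - linePoint t) * z ^ (-linePoint t)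

/-- On the half-plane `Re z ≥ 0` the factor `z ^ (-s)` grows at most like `e ^ (π |t| / 2)`, while
`Γ(s) Γ(n - s)` decays like `e ^ (-π |t|)` by the reflection formula. -/
theorem norm_barnesIntegrand_le {n : ℕ} (hn : 1 ≤ n) : ∃ C : ℝ, 0 ≤ C ∧ ∀ z : ℂ, z ≠ 0 → 0 ≤ z.re →
    ∀ t : ℝ, ‖barnesIntegrand n z t‖ ≤ C * ‖z‖ ^ (-3 / 2 : ℝ) * (1 + t ^ 2)⁻¹ := by
  obtain ⟨m, rfl⟩ : ∃ m, n = m + 1 := ⟨n - 1, by lia⟩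
  have hG : 0 < Real.Gamma (5 / 2) := Real.Gamma_pos_of_pos (by norm_num)
  have hpi := Real.pi_pos
  have hpi3 := Real.pi_gt_three
  refine ⟨2 * Real.pi * Real.Gamma (5 / 2) * ((m + 2).factorial * Real.exp (m + 2)),
    by positivity, fun z hz hre t => ?_⟩
  have h1 : ‖Gamma (linePoint t + 1)‖ ≤ Real.Gamma (5 / 2) := by
    have e : (linePoint t + 1).re = 5 / 2 := by rw [add_re, linePoint_re, one_re]; norm_num
    have := norm_Gamma_le (s := linePoint t + 1) (by rw [e]; norm_num)
    rwa [e] at this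
  have h2 := norm_Gamma_nat_sub_linePoint_le m t
  have h3 := norm_Gamma_mul_Gamma_one_sub_linePoint t
  have hcosh : Real.exp (Real.pi * |t|) / 2 ≤ Real.cosh (Real.pi * t) := by
    rw [← Real.cosh_abs, abs_mul, abs_of_pos hpi, Real.cosh_eq]
    linarith [Real.exp_pos (-(Real.pi * |t|))]
  have h4 : ‖z ^ (-linePoint t)‖ ≤ ‖z‖ ^ (-3 / 2 : ℝ) * Real.exp (Real.pi / 2 * |t|) := by
    rw [norm_cpow_of_ne_zero hz, neg_re, neg_im, linePoint_re, linePoint_im, div_eq_mul_inv,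
      ← Real.exp_neg, mul_neg, neg_neg, neg_div]
    refine mul_le_mul_of_nonneg_left (Real.exp_le_exp.2 ?_) (by positivity)
    have harg := abs_arg_le_pi_div_two_iff.2 hre
    calc arg z * t ≤ |arg z * t| := le_abs_self _
      _ = |arg z| * |t| := abs_mul _ _
      _ ≤ _ := by gcongr
  have h5 : Real.pi / Real.cosh (Real.pi * t) ≤ 2 * Real.pi * Real.exp (-(Real.pi * |t|)) := by
    rw [div_le_iff₀ (Real.cosh_pos _), Real.exp_neg]
    have he := Real.exp_pos (Real.pi * |t|)
    calc Real.pi = 2 * Real.pi * (Real.exp (Real.pi * |t|))⁻¹ * (Real.exp (Real.pi * |t|) / 2) := by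
          field_simp
      _ ≤ _ := by gcongr
  have h6 : (m + 2 + |t|) ^ m * Real.exp (-(Real.pi * |t|)) * Real.exp (Real.pi / 2 * |t|) ≤
      (m + 2).factorial * Real.exp (m + 2) * (1 + t ^ 2)⁻¹ := by
    have ht := abs_nonneg t
    have hm : (0 : ℝ) ≤ m := m.cast_nonneg
    have h7 := Real.pow_div_factorial_le_exp (m + 2 + |t|) (by positivity) (m + 2)
    rw [div_le_iff₀ (by positivity)] at h7
    have h8 : 1 + t ^ 2 ≤ (m + 2 + |t|) ^ 2 := by nlinarith [sq_abs t]
    have h9 : Real.exp (-(Real.pi * |t|)) * Real.exp (Real.pi / 2 * |t|) ≤ Real.exp (-|t|) := by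
      rw [← Real.exp_add, Real.exp_le_exp]
      nlinarith
    rw [← div_eq_mul_inv, le_div_iff₀ (by positivity), mul_assoc ((m + 2 + |t|) ^ m)]
    calc (m + 2 + |t|) ^ m * (Real.exp (-(Real.pi * |t|)) * Real.exp (Real.pi / 2 * |t|)) *
          (1 + t ^ 2) ≤ (m + 2 + |t|) ^ m * Real.exp (-|t|) * (m + 2 + |t|) ^ 2 := by gcongr
      _ = (m + 2 + |t|) ^ (m + 2) * Real.exp (-|t|) := by ring
      _ ≤ Real.exp (m + 2 + |t|) * (m + 2).factorial * Real.exp (-|t|) := by gcongr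
      _ = (m + 2).factorial * (Real.exp (m + 2 + |t|) * Real.exp (-|t|)) := by ring
      _ = _ := by rw [← Real.exp_add, add_neg_cancel_right]
  have e : ‖barnesIntegrand (m + 1) z t‖ = ‖Gamma (linePoint t)‖ * ‖Gamma (linePoint t + 1)‖ *
      ‖Gamma (((m + 1 : ℕ) : ℂ) - linePoint t)‖ * ‖z ^ (-linePoint t)‖ := by
    rw [barnesIntegrand, norm_mul, norm_mul, norm_mul]
  rw [norm_mul] at h3
  rw [e]
  calc _ ≤ ‖Gamma (linePoint t)‖ * Real.Gamma (5 / 2) *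
        ((m + 2 + |t|) ^ m * ‖Gamma (1 - linePoint t)‖) *
        (‖z‖ ^ (-3 / 2 : ℝ) * Real.exp (Real.pi / 2 * |t|)) := by gcongr
    _ = Real.Gamma (5 / 2) * (m + 2 + |t|) ^ m *
        (‖Gamma (linePoint t)‖ * ‖Gamma (1 - linePoint t)‖) *
        (‖z‖ ^ (-3 / 2 : ℝ) * Real.exp (Real.pi / 2 * |t|)) := by ring
    _ ≤ Real.Gamma (5 / 2) * (m + 2 + |t|) ^ m * (2 * Real.pi * Real.exp (-(Real.pi * |t|))) *
        (‖z‖ ^ (-3 / 2 : ℝ) * Real.exp (Real.pi / 2 * |t|)) := by rw [h3]; gcongr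
    _ = 2 * Real.pi * Real.Gamma (5 / 2) * ‖z‖ ^ (-3 / 2 : ℝ) *
        ((m + 2 + |t|) ^ m * Real.exp (-(Real.pi * |t|)) * Real.exp (Real.pi / 2 * |t|)) := by ring
    _ ≤ 2 * Real.pi * Real.Gamma (5 / 2) * ‖z‖ ^ (-3 / 2 : ℝ) *
        ((m + 2).factorial * Real.exp (m + 2) * (1 + t ^ 2)⁻¹) := by gcongr
    _ = _ := by ring

theorem continuous_barnesIntegrand {n : ℕ} (hn : 2 ≤ n) {z : ℂ} (hz : z ≠ 0) :
    Continuous (barnesIntegrand n z) := by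
  have hG : ∀ f : ℝ → ℂ, Continuous f → (∀ t, 0 < (f t).re) → Continuous fun t => Gamma (f t) := by
    intro f hf hpos
    rw [continuous_iff_continuousAt]
    intro t
    have hd := Complex.differentiableAt_Gamma (f t) (fun m h => by
      have := hpos t
      rw [h, neg_re, natCast_re] at this
      have h2 : (0 : ℝ) ≤ m := m.cast_nonneg
      linarith)
    exact ContinuousAt.comp (f := f) hd.continuousAt hf.continuousAt
  have hl : Continuous linePoint := by unfold linePoint; fun_prop
  have hn' : (2 : ℝ) ≤ n := by exact_mod_cast hn
  unfold barnesIntegrand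
  refine (((hG _ hl ?_).mul (hG _ (hl.add continuous_const) ?_)).mul
    (hG _ (continuous_const.sub hl) ?_)).mul ?_
  · intro t; rw [linePoint_re]; norm_num
  · intro t; rw [Pi.add_apply, add_re, linePoint_re, one_re]; norm_num
  · intro t; rw [Pi.sub_apply, sub_re, linePoint_re, natCast_re]; linarith
  · exact hl.neg.const_cpow (Or.inl hz)

theorem integrable_barnesIntegrand {n : ℕ} (hn : 2 ≤ n) {z : ℂ} (hz : z ≠ 0) (hre : 0 ≤ z.re) :
    Integrable (barnesIntegrand n z) := by
  obtain ⟨C, -, h⟩ := norm_barnesIntegrand_le (n := n) (by lia)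
  exact (integrable_inv_one_add_sq.const_mul _).mono'
    (continuous_barnesIntegrand hn hz).aestronglyMeasurable (Eventually.of_forall (h z hz hre))

theorem continuousWithinAt_integral_barnesIntegrand {n : ℕ} (hn : 2 ≤ n) {z₀ : ℂ}
    (hz₀ : z₀ ∈ slitPlane) (hz1 : 1 < ‖z₀‖) :
    ContinuousWithinAt (fun z => ∫ t, barnesIntegrand n z t) {z | 0 < z.re} z₀ := by
  obtain ⟨C, hC, h⟩ := norm_barnesIntegrand_le (n := n) (by lia)
  have hnorm : ∀ᶠ z : ℂ in 𝓝[{z | 0 < z.re}] z₀, 1 < ‖z‖ :=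
    nhdsWithin_le_nhds (continuous_norm.continuousAt.eventually_const_lt hz1)
  refine continuousWithinAt_of_dominated (bound := fun t => C * (1 + t ^ 2)⁻¹) ?_ ?_
    (integrable_inv_one_add_sq.const_mul _) ?_
  · filter_upwards [hnorm] with z hz
    refine (continuous_barnesIntegrand hn ?_).aestronglyMeasurable
    rintro rfl
    simp at hz
    linarith
  · filter_upwards [hnorm, self_mem_nhdsWithin] with z hz hre
    have hz0 : z ≠ 0 := by
      rintro rfl
      simp at hz
      linarith
    refine Eventually.of_forall fun t => (h z hz0 (le_of_lt hre) t).trans ?_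
    have : ‖z‖ ^ (-3 / 2 : ℝ) ≤ 1 := Real.rpow_le_one_of_one_le_of_nonpos hz.le (by norm_num)
    have h3 : 0 ≤ (1 + t ^ 2)⁻¹ := by positivity
    calc _ ≤ C * 1 * (1 + t ^ 2)⁻¹ := by gcongr
      _ = _ := by ring
  · refine Eventually.of_forall fun t => ContinuousAt.continuousWithinAt ?_
    unfold barnesIntegrand
    exact continuousAt_const.mul (continuousAt_id.cpow continuousAt_const hz₀)

/-! ### Mellin inversion -/

theorem ratio_pos {y : ℝ} (hy : y ∈ Ioo (0 : ℝ) 1) : 0 < y / (1 - y) :=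
  div_pos hy.1 (by linarith [hy.2])

theorem norm_eulerIntegrand_le (n : ℕ) {z : ℂ} (hz : 0 ≤ z.re) {y : ℝ} (hy : y ∈ Ioo (0 : ℝ) 1) :
    ‖(y : ℂ) ^ (n - 1) * Complex.exp (-(z * (y / (1 - y) : ℝ)))‖ ≤ 1 := by
  have hc := ratio_pos hy
  rw [norm_mul, norm_pow, norm_real, Real.norm_of_nonneg hy.1.le, Complex.norm_exp, neg_re,
    re_mul_ofReal]
  refine mul_le_one₀ (pow_le_one₀ hy.1.le hy.2.le) (Real.exp_pos _).le (Real.exp_le_one_iff.2 ?_)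
  have : 0 ≤ z.re * (y / (1 - y)) := by positivity
  linarith

/-- At a boundary point `z₀` with `Re z₀ = 0` this is the limit from inside the half-plane. -/
theorem continuousWithinAt_eulerIntegral (n : ℕ) (z₀ : ℂ) :
    ContinuousWithinAt (eulerIntegral n) {z | 0 < z.re} z₀ := by
  refine continuousWithinAt_of_dominated (bound := fun _ => 1) ?_ ?_ (integrable_const _) ?_
  · refine Eventually.of_forall fun z => Measurable.aestronglyMeasurable (by fun_prop)
  · filter_upwards [self_mem_nhdsWithin] with z hz
    filter_upwards [ae_restrict_mem measurableSet_Ioo] with y hy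
    exact norm_eulerIntegrand_le n (le_of_lt hz) hy
  · exact Eventually.of_forall fun y => ContinuousAt.continuousWithinAt (by fun_prop)

/-- The function of two variables whose iterated integrals compute the Mellin transform of
`x ↦ eulerIntegral n (x * z)`. -/
noncomputable def mellinKernel (n : ℕ) (z s : ℂ) (p : ℝ × ℝ) : ℂ :=
  (p.1 : ℂ) ^ (s - 1) * ((p.2 : ℂ) ^ (n - 1) *
    Complex.exp (-(p.1 * z * (p.2 / (1 - p.2) : ℝ))))

theorem integral_norm_mellinKernel {n : ℕ} {z s : ℂ} (hz : 0 < z.re) (hs : 0 < s.re) {y : ℝ}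
    (hy : y ∈ Ioo (0 : ℝ) 1) :
    IntegrableOn (fun x => mellinKernel n z s (x, y)) (Ioi 0) ∧
    ∫ x in Ioi 0, ‖mellinKernel n z s (x, y)‖ =
      y ^ (n - 1) * ((1 / (z.re * (y / (1 - y)))) ^ s.re * Real.Gamma s.re) := by
  have hc := ratio_pos hy
  have hβ : 0 < z.re * (y / (1 - y)) := by positivity
  have hnorm : ∀ x ∈ Ioi (0 : ℝ), ‖mellinKernel n z s (x, y)‖ =
      y ^ (n - 1) * (x ^ (s.re - 1) * Real.exp (-(z.re * (y / (1 - y)) * x))) := by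
    intro x hx
    have e : (-(x * z * (y / (1 - y) : ℝ)) : ℂ).re = -(z.re * (y / (1 - y)) * x) := by
      rw [neg_re, re_mul_ofReal, re_ofReal_mul]; ring
    simp only [mellinKernel]
    rw [norm_mul, norm_mul, norm_pow, norm_real, Real.norm_of_nonneg hy.1.le, Complex.norm_exp, e,
      norm_cpow_eq_rpow_re_of_pos hx, sub_re, one_re]
    ring
  have hint : IntegrableOn (fun x : ℝ => y ^ (n - 1) *
      (x ^ (s.re - 1) * Real.exp (-(z.re * (y / (1 - y)) * x)))) (Ioi 0) := by
    refine Integrable.const_mul ?_ _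
    refine (integrableOn_rpow_mul_exp_neg_mul_rpow (p := 1) (s := s.re - 1) (by linarith) one_pos
      hβ).congr_fun (fun x _ => ?_) measurableSet_Ioi
    simp
  constructor
  · refine hint.mono' (Measurable.aestronglyMeasurable ?_) ?_
    · unfold mellinKernel; fun_prop
    · filter_upwards [ae_restrict_mem measurableSet_Ioi] with x hx
      exact (hnorm x hx).le
  · rw [setIntegral_congr_fun measurableSet_Ioi hnorm, integral_const_mul,
      Real.integral_rpow_mul_exp_neg_mul_Ioi hs hβ]

theorem integrable_mellinKernel {n : ℕ} {z s : ℂ} (hz : 0 < z.re) (hs : 0 < s.re)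
    (hsn : s.re < n) : Integrable (mellinKernel n z s)
      ((volume.restrict (Ioi 0)).prod (volume.restrict (Ioo (0 : ℝ) 1))) := by
  have hmeas : AEStronglyMeasurable (mellinKernel n z s)
      ((volume.restrict (Ioi 0)).prod (volume.restrict (Ioo (0 : ℝ) 1))) := by
    refine Measurable.aestronglyMeasurable ?_
    unfold mellinKernel
    fun_prop
  have hn : 1 ≤ n := by
    have : (0 : ℝ) < n := by linarith
    exact_mod_cast this
  rw [integrable_prod_iff' hmeas]
  constructor
  · filter_upwards [ae_restrict_mem measurableSet_Ioo] with y hy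
    exact (integral_norm_mellinKernel hz hs hy).1
  · have hdom : IntegrableOn (fun y : ℝ => z.re ^ (-s.re) * Real.Gamma s.re * y ^ (n - 1 - s.re))
        (Ioo 0 1) :=
      ((intervalIntegral.integrableOn_Ioo_rpow_iff one_pos).2 (by linarith)).const_mul _
    refine hdom.mono' hmeas.norm.prod_swap.integral_prod_right' ?_
    filter_upwards [ae_restrict_mem measurableSet_Ioo] with y hy
    have hc := ratio_pos hy
    have hy1 : 0 < 1 - y := by linarith [hy.2]
    have hG := Real.Gamma_pos_of_pos hs
    rw [Real.norm_of_nonneg (integral_nonneg fun _ => norm_nonneg _),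
      (integral_norm_mellinKernel hz hs hy).2]
    have e1 : (1 / (z.re * (y / (1 - y)))) ^ s.re =
        z.re ^ (-s.re) * (y ^ (-s.re) * (1 - y) ^ s.re) := by
      rw [one_div, Real.inv_rpow (by positivity), ← Real.rpow_neg (by positivity),
        Real.mul_rpow hz.le hc.le, Real.div_rpow hy.1.le hy1.le, Real.rpow_neg hy1.le, div_inv_eq_mul]
    have e2 : y ^ (n - 1 - s.re : ℝ) = y ^ (n - 1) * y ^ (-s.re) := by
      rw [← Real.rpow_natCast, ← Real.rpow_add hy.1, Nat.cast_sub hn, Nat.cast_one, sub_eq_add_neg]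
    have e3 : (1 - y) ^ s.re ≤ 1 := Real.rpow_le_one hy1.le (by linarith [hy.1]) hs.le
    rw [e1, e2]
    have hyp : 0 ≤ y ^ (-s.re) := Real.rpow_nonneg hy.1.le _
    have hyn : 0 ≤ y ^ (n - 1) := pow_nonneg hy.1.le _
    have hzp : 0 ≤ z.re ^ (-s.re) := Real.rpow_nonneg hz.le _
    calc _ ≤ y ^ (n - 1) * ((z.re ^ (-s.re) * (y ^ (-s.re) * 1)) * Real.Gamma s.re) := by gcongr
      _ = _ := by ring

theorem integral_mellinKernel {n : ℕ} (hn : 1 ≤ n) {z s : ℂ} (hz : 0 < z.re) (hs : 0 < s.re)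
    {y : ℝ} (hy : y ∈ Ioo (0 : ℝ) 1) :
    ∫ x in Ioi 0, mellinKernel n z s (x, y) =
      Gamma s * z ^ (-s) * ((y : ℂ) ^ ((n - s) - 1) * (1 - (y : ℂ)) ^ ((s + 1) - 1)) := by
  have hc := ratio_pos hy
  have hz0 : z ≠ 0 := by rintro rfl; simp at hz
  have hy0 : (y : ℂ) ≠ 0 := by exact_mod_cast hy.1.ne'
  have hy1 : 0 < 1 - y := by linarith [hy.2]
  have hc0 : ((y / (1 - y) : ℝ) : ℂ) ≠ 0 := by exact_mod_cast hc.ne'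
  have hcs : (((y / (1 - y) : ℝ) : ℂ) * z) ^ (-s) =
      z ^ (-s) * ((y : ℂ) ^ (-s) * (1 - (y : ℂ)) ^ s) := by
    have h1 : (1 - (y : ℂ)) = ((1 - y : ℝ) : ℂ) := by push_cast; ring
    have h2 : ((1 - y : ℝ) : ℂ) ≠ 0 := by exact_mod_cast hy1.ne'
    rw [h1, cpow_def_of_ne_zero (mul_ne_zero hc0 hz0), cpow_def_of_ne_zero hz0,
      cpow_def_of_ne_zero hy0, cpow_def_of_ne_zero h2, Complex.log_ofReal_mul hc hz0,
      ← ofReal_log hy.1.le, ← ofReal_log hy1.le, Real.log_div hy.1.ne' hy1.ne', ← Complex.exp_add,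
      ← Complex.exp_add]
    congr 1
    push_cast
    ring
  have hr : 0 < (((y / (1 - y) : ℝ) : ℂ) * z).re := by rw [re_ofReal_mul]; positivity
  have e : ∀ x : ℝ, mellinKernel n z s (x, y) = (y : ℂ) ^ (n - 1) *
      ((x : ℂ) ^ (s - 1) * Complex.exp (-(((y / (1 - y) : ℝ) : ℂ) * z * x))) := by
    intro x
    simp only [mellinKernel]
    rw [show (x * z * (y / (1 - y) : ℝ) : ℂ) = ((y / (1 - y) : ℝ) : ℂ) * z * x by ring]
    ring
  simp_rw [e]
  rw [integral_const_mul, integral_cpow_mul_exp_neg_mul_Ioi_of_re_pos hs hr, hcs,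
    show (n - s - 1 : ℂ) = ((n - 1 : ℕ) : ℂ) + -s by push_cast [Nat.cast_sub hn]; ring,
    cpow_add _ _ hy0, cpow_natCast, add_sub_cancel_right]
  ring

theorem mellin_eulerIntegral {n : ℕ} {z s : ℂ} (hz : 0 < z.re) (hs : 0 < s.re) (hsn : s.re < n) :
    MellinConvergent (fun x : ℝ => eulerIntegral n (x * z)) s ∧
    mellin (fun x : ℝ => eulerIntegral n (x * z)) s =
      Gamma s * Gamma (s + 1) * Gamma (n - s) * z ^ (-s) / n.factorial := by
  have hn : 1 ≤ n := by
    have : (0 : ℝ) < n := by linarith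
    exact_mod_cast this
  have hk := integrable_mellinKernel hz hs hsn
  have hinner : ∀ x : ℝ, ∫ y in Ioo (0 : ℝ) 1, mellinKernel n z s (x, y) =
      (x : ℂ) ^ (s - 1) • eulerIntegral n (x * z) := by
    intro x
    simp only [mellinKernel, eulerIntegral, smul_eq_mul]
    rw [integral_const_mul]
  constructor
  · have := hk.integral_prod_left
    simp_rw [hinner] at this
    exact this
  · have hns : 0 < (n - s : ℂ).re := by rw [sub_re, natCast_re]; linarith
    have hs1 : 0 < (s + 1).re := by rw [add_re, one_re]; linarith
    have hbeta := Gamma_mul_Gamma_eq_betaIntegral hns hs1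
    have hfac : Gamma (n - s + (s + 1)) = n.factorial := by
      rw [show (n - s + (s + 1) : ℂ) = n + 1 by ring, Gamma_nat_eq_factorial]
    have hf0 : (n.factorial : ℂ) ≠ 0 := by exact_mod_cast n.factorial_ne_zero
    rw [mellin]
    simp_rw [← hinner]
    rw [integral_integral_swap (f := fun x y => mellinKernel n z s (x, y)) hk,
      setIntegral_congr_fun measurableSet_Ioo (fun y hy => integral_mellinKernel hn hz hs hy),
      integral_const_mul, ← integral_Ioc_eq_integral_Ioo,
      ← intervalIntegral.integral_of_le zero_le_one, eq_div_iff hf0]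
    change _ * betaIntegral (n - s) (s + 1) * _ = _
    rw [hfac] at hbeta
    linear_combination (-Gamma s * z ^ (-s)) * hbeta

theorem eulerIntegral_eq_of_re_pos {n : ℕ} (hn : 2 ≤ n) {z : ℂ} (hz : 0 < z.re) :
    eulerIntegral n z = (2 * Real.pi * n.factorial : ℂ)⁻¹ * ∫ t, barnesIntegrand n z t := by
  have hn' : (2 : ℝ) ≤ n := by exact_mod_cast hn
  have hz0 : z ≠ 0 := by rintro rfl; simp at hz
  have hline : ∀ t : ℝ, ((3 / 2 : ℝ) : ℂ) + t * I = linePoint t := by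
    intro t; rw [linePoint]; push_cast; ring
  have hmellin : ∀ t : ℝ, mellin (fun x : ℝ => eulerIntegral n (x * z)) (linePoint t) =
      barnesIntegrand n z t / n.factorial := by
    intro t
    exact (mellin_eulerIntegral hz (by rw [linePoint_re]; norm_num)
      (by rw [linePoint_re]; linarith)).2
  have hconv : MellinConvergent (fun x : ℝ => eulerIntegral n (x * z)) ((3 / 2 : ℝ) : ℂ) :=
    (mellin_eulerIntegral hz (by rw [ofReal_re]; norm_num) (by rw [ofReal_re]; linarith)).1
  have hvert : VerticalIntegrable (mellin fun x : ℝ => eulerIntegral n (x * z)) (3 / 2) := by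
    rw [VerticalIntegrable]
    simp_rw [hline, hmellin]
    exact (integrable_barnesIntegrand hn hz0 hz.le).div_const _
  have hcont : ContinuousAt (fun x : ℝ => eulerIntegral n (x * z)) 1 := by
    have h1 : ContinuousAt (eulerIntegral n) (((1 : ℝ) : ℂ) * z) :=
      (continuousWithinAt_eulerIntegral n _).continuousAt
        ((isOpen_lt continuous_const continuous_re).mem_nhds (by simpa using hz))
    exact ContinuousAt.comp (f := fun x : ℝ => (x : ℂ) * z) h1 (by fun_prop)
  have h := mellinInv_mellin_eq (3 / 2) _ one_pos hconv hvert hcont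
  rw [mellinInv] at h
  simp_rw [hline, hmellin] at h
  simp only [ofReal_one, one_cpow, one_smul, one_mul] at h
  rw [← h, integral_div, real_smul]
  push_cast
  field_simp

/-- Mellin inversion, continued to the boundary of the half-plane `Re z > 0`. -/
theorem eulerIntegral_eq {n : ℕ} (hn : 2 ≤ n) {z : ℂ} (hz : z ∈ slitPlane) (hre : 0 ≤ z.re)
    (hnorm : 1 < ‖z‖) :
    eulerIntegral n z = (2 * Real.pi * n.factorial : ℂ)⁻¹ * ∫ t, barnesIntegrand n z t := by
  have hmem : z ∈ closure {w : ℂ | 0 < w.re} := by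
    rw [Complex.closure_setOfPred_lt_re]; exact hre
  have : (𝓝[{w : ℂ | 0 < w.re}] z).NeBot := mem_closure_iff_nhdsWithin_neBot.1 hmem
  have h1 := (continuousWithinAt_eulerIntegral n z).tendsto
  have h2 := ((continuousWithinAt_integral_barnesIntegrand hn hz hnorm).tendsto).const_mul
    ((2 * Real.pi * n.factorial : ℂ)⁻¹)
  refine tendsto_nhds_unique h1 (h2.congr' ?_)
  filter_upwards [self_mem_nhdsWithin] with w hw
  exact (eulerIntegral_eq_of_re_pos hn hw).symm

theorem eulerIntegral_conj (n : ℕ) (z : ℂ) :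
    eulerIntegral n ((starRingEnd ℂ) z) = (starRingEnd ℂ) (eulerIntegral n z) := by
  unfold eulerIntegral
  rw [← integral_conj]
  congr 1
  ext y
  rw [map_mul, map_pow, conj_ofReal, ← Complex.exp_conj, map_neg, map_mul, conj_ofReal]

/-! ### From the Mellin-Barnes integral to the saddle point integral -/

theorem two_pi_I_re : (2 * Real.pi * I : ℂ).re = 0 := by simp

theorem two_pi_I_im : (2 * Real.pi * I : ℂ).im = 2 * Real.pi := by simp

theorem norm_two_pi_I : ‖(2 * Real.pi * I : ℂ)‖ = 2 * Real.pi := by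
  simp [abs_of_pos Real.pi_pos]

/-- `cos (π s / 2) (2π) ^ (-s)` is the mean of `(2πi) ^ (-s)` and `(-2πi) ^ (-s)`. -/
theorem integrand_linePoint (n : ℕ) (t : ℝ) :
    integrand n 1 (3 / 2 + t * I) =
      1 / 2 * (barnesIntegrand n (2 * Real.pi * I) t + barnesIntegrand n (-(2 * Real.pi * I)) t) := by
  have h1 : (2 * Real.pi * I : ℂ) = ((2 * Real.pi : ℝ) : ℂ) * I := by push_cast; ring
  have h2 : (-(2 * Real.pi * I) : ℂ) = ((2 * Real.pi : ℝ) : ℂ) * -I := by push_cast; ring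
  have hp : ((2 * Real.pi : ℝ) : ℂ) ≠ 0 := by exact_mod_cast two_pi_pos.ne'
  have e1 : ∀ s : ℂ, (2 * Real.pi * I : ℂ) ^ (-s) = ((2 * Real.pi : ℝ) : ℂ) ^ (-s) *
      Complex.exp (-(Real.pi * s / 2) * I) := by
    intro s
    rw [h1, cpow_def_of_ne_zero (mul_ne_zero hp I_ne_zero), cpow_def_of_ne_zero hp,
      log_ofReal_mul two_pi_pos I_ne_zero, log_I, ofReal_log two_pi_pos.le, ← Complex.exp_add]
    congr 1; ring
  have e2 : ∀ s : ℂ, (-(2 * Real.pi * I) : ℂ) ^ (-s) = ((2 * Real.pi : ℝ) : ℂ) ^ (-s) *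
      Complex.exp ((Real.pi * s / 2) * I) := by
    intro s
    rw [h2, cpow_def_of_ne_zero (mul_ne_zero hp (neg_ne_zero.2 I_ne_zero)),
      cpow_def_of_ne_zero hp, log_ofReal_mul two_pi_pos (neg_ne_zero.2 I_ne_zero), log_neg_I,
      ofReal_log two_pi_pos.le, ← Complex.exp_add]
    congr 1; ring
  simp only [integrand, barnesIntegrand, linePoint]
  rw [mul_one, e1, e2, Complex.cos]
  ring

theorem integrable_integrand {n : ℕ} (hn : 2 ≤ n) :
    Integrable fun t : ℝ => integrand n 1 (3 / 2 + t * I) := by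
  simp_rw [integrand_linePoint]
  refine ((integrable_barnesIntegrand hn two_pi_I_ne_zero ?_).add
    (integrable_barnesIntegrand hn (neg_ne_zero.2 two_pi_I_ne_zero) ?_)).const_mul _
  · rw [two_pi_I_re]
  · rw [neg_re, two_pi_I_re, neg_zero]

theorem neg_four_div_factorial_mul_I {n : ℕ} (hn : 2 ≤ n) :
    -(4 / (n.factorial : ℂ)) * BettinConrey.I n 1 =
      2 * (saddleIntegral n + (starRingEnd ℂ) (saddleIntegral n)) := by
  have hpi := Real.pi_gt_three
  have hp : (Real.pi : ℂ) ≠ 0 := by exact_mod_cast Real.pi_ne_zero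
  have hf0 : (n.factorial : ℂ) ≠ 0 := by exact_mod_cast n.factorial_ne_zero
  have hconj : -(2 * Real.pi * I : ℂ) = (starRingEnd ℂ) (2 * Real.pi * I) := by
    simp [map_ofNat]
  have h1 : eulerIntegral n (2 * Real.pi * I) = _ := eulerIntegral_eq hn
    (by rw [mem_slitPlane_iff, two_pi_I_im]; right; positivity) (by rw [two_pi_I_re])
    (by rw [norm_two_pi_I]; linarith)
  have h2 : eulerIntegral n (-(2 * Real.pi * I)) = _ := eulerIntegral_eq hn
    (by rw [mem_slitPlane_iff, neg_im, two_pi_I_im]; right; linarith)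
    (by rw [neg_re, two_pi_I_re, neg_zero]) (by rw [norm_neg, norm_two_pi_I]; linarith)
  rw [eulerIntegral_two_pi_I (by lia)] at h1
  rw [hconj, eulerIntegral_conj, ← hconj, eulerIntegral_two_pi_I (by lia), map_neg] at h2
  have h3 : BettinConrey.I n 1 = 1 / (2 * Real.pi * I) * (1 / 2 *
      ((∫ t, barnesIntegrand n (2 * Real.pi * I) t) +
        ∫ t, barnesIntegrand n (-(2 * Real.pi * I)) t) * I) := by
    rw [BettinConrey.I, integral_mul_const]
    simp_rw [integrand_linePoint]
    rw [integral_const_mul, integral_add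
      (integrable_barnesIntegrand hn two_pi_I_ne_zero (by rw [two_pi_I_re]))
      (integrable_barnesIntegrand hn (neg_ne_zero.2 two_pi_I_ne_zero)
        (by rw [neg_re, two_pi_I_re, neg_zero]))]
  rw [inv_mul_eq_div, eq_div_iff (by simp [hp, hf0])] at h1 h2
  rw [h3, ← h1, ← h2]
  have hI := I_ne_zero
  field_simp
  ring

/-- Twice the sum of the `l`-th term of the saddle point expansion and its conjugate is the `l`-th term
of the real expansion. -/
theorem two_mul_expansion_term_add_conj {n : ℝ} (hn : 0 < n) (l : ℕ) :
    2 * (Complex.exp (-(2 * saddleArg n)) * Real.sqrt Real.pi * (Ctilde l *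
        (Complex.exp ((Real.log (2 * Real.pi) / 2 + Real.pi / 4 * I) * (1 / 2 - l)) *
          ((n ^ (-(l : ℝ) / 2 - 3 / 4) : ℝ) : ℂ))) +
      (starRingEnd ℂ) (Complex.exp (-(2 * saddleArg n)) * Real.sqrt Real.pi * (Ctilde l *
        (Complex.exp ((Real.log (2 * Real.pi) / 2 + Real.pi / 4 * I) * (1 / 2 - l)) *
          ((n ^ (-(l : ℝ) / 2 - 3 / 4) : ℝ) : ℂ))))) =
    ((2 ^ (9 / 4 : ℝ) * Real.pi ^ (3 / 4 : ℝ)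
                * Real.exp (-2 * Real.sqrt (Real.pi * n)) : ℝ) : ℂ) *
      ((((2 * Real.pi) ^ (-(l : ℝ) / 2) : ℝ) : ℂ) * Ctilde l
                  * (((n : ℝ) ^ (-(l : ℝ) / 2 - 3 / 4)
                      * Real.sin (2 * Real.sqrt (Real.pi * n) + Real.pi * l / 4
                          + 3 * Real.pi / 8) : ℝ) : ℂ)) := by
  set r : ℝ := Real.sqrt (Real.pi * n) with hr
  set θ : ℝ := 2 * r + Real.pi * l / 4 - Real.pi / 8 with hθ
  have hW : saddleArg n = r + r * I := by
    rw [← re_add_im (saddleArg n), saddleArg_re hn, saddleArg_im hn]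
  -- the two exponentials combine to a modulus and the phase `e ^ (-iθ)`
  have hexp : Complex.exp (-(2 * saddleArg n)) *
      Complex.exp ((Real.log (2 * Real.pi) / 2 + Real.pi / 4 * I) * (1 / 2 - l)) =
      ((Real.exp (-2 * r) * ((2 * Real.pi) ^ (1 / 4 : ℝ) * (2 * Real.pi) ^ (-(l : ℝ) / 2)) : ℝ) : ℂ)
        * Complex.exp (-(θ * I)) := by
    rw [← Real.rpow_add two_pi_pos, Real.rpow_def_of_pos two_pi_pos, ← Real.exp_add, ofReal_exp,
      ← Complex.exp_add, ← Complex.exp_add, hW, hθ]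
    congr 1
    push_cast
    ring
  have hcos : Complex.exp (-(θ * I)) + (starRingEnd ℂ) (Complex.exp (-(θ * I))) =
      2 * ((Real.sin (2 * r + Real.pi * l / 4 + 3 * Real.pi / 8) : ℝ) : ℂ) := by
    have : 2 * r + Real.pi * l / 4 + 3 * Real.pi / 8 = θ + Real.pi / 2 := by rw [hθ]; ring
    rw [this, Real.sin_add_pi_div_two, ofReal_cos, Complex.cos, ← Complex.exp_conj]
    simp only [map_neg, map_mul, conj_ofReal, conj_I, mul_neg, neg_neg, neg_mul]
    ring
  have hconst : 4 * Real.sqrt Real.pi * (2 * Real.pi) ^ (1 / 4 : ℝ) =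
      2 ^ (9 / 4 : ℝ) * Real.pi ^ (3 / 4 : ℝ) := by
    rw [Real.sqrt_eq_rpow, Real.mul_rpow zero_le_two Real.pi_pos.le,
      show (9 / 4 : ℝ) = 2 + 1 / 4 by norm_num, show (3 / 4 : ℝ) = 1 / 2 + 1 / 4 by norm_num,
      Real.rpow_add two_pos, Real.rpow_add Real.pi_pos]
    norm_num
    ring
  set A : ℝ := Real.exp (-2 * r) * ((2 * Real.pi) ^ (1 / 4 : ℝ) * (2 * Real.pi) ^ (-(l : ℝ) / 2))
    with hA
  set b : ℝ := n ^ (-(l : ℝ) / 2 - 3 / 4)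
  have hterm : Complex.exp (-(2 * saddleArg n)) * Real.sqrt Real.pi * (Ctilde l *
        (Complex.exp ((Real.log (2 * Real.pi) / 2 + Real.pi / 4 * I) * (1 / 2 - l)) * (b : ℂ))) =
      ((Real.sqrt Real.pi * A * b : ℝ) : ℂ) * Ctilde l * Complex.exp (-(θ * I)) := by
    push_cast
    linear_combination (Real.sqrt Real.pi * Ctilde l * b : ℂ) * hexp
  rw [hterm, map_mul, map_mul, conj_ofReal, conj_Ctilde, ← mul_add, hcos, ← hconst, hA]
  push_cast
  ring

end MellinBarnes

theorem proposition5p1 (L : ℕ) (hL : 1 ≤ L) :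
    (∀ n : ℕ, 2 ≤ n → MeasureTheory.Integrable
      (fun t : ℝ => BettinConrey.integrand n 1 (3 / 2 + t * Complex.I))) ∧
    Asymptotics.IsBigO Filter.atTop
      (fun n : ℕ =>
        -(4 / (n.factorial : ℂ)) * BettinConrey.I n 1
          - ((2 ^ (9 / 4 : ℝ) * Real.pi ^ (3 / 4 : ℝ)
                * Real.exp (-2 * Real.sqrt (Real.pi * n)) : ℝ) : ℂ)
            * ∑ l ∈ Finset.range (L + 1),
                (((2 * Real.pi) ^ (-(l : ℝ) / 2) : ℝ) : ℂ) * BettinConrey.Ctilde l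
                  * (((n : ℝ) ^ (-(l : ℝ) / 2 - 3 / 4)
                      * Real.sin (2 * Real.sqrt (Real.pi * n) + Real.pi * l / 4
                          + 3 * Real.pi / 8) : ℝ) : ℂ))
      (fun n : ℕ =>
        (n : ℝ) ^ (-(L : ℝ) / 2 - 5 / 4) * Real.exp (-2 * Real.sqrt (Real.pi * n))) := by
  refine ⟨fun n hn => MellinBarnes.integrable_integrand hn, ?_⟩
  obtain ⟨K, hK⟩ := MellinBarnes.saddleIntegral_expansion L
  refine Asymptotics.IsBigO.of_bound (4 * K) ?_
  filter_upwards [Filter.eventually_ge_atTop 2] with n hn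
  have hn1 : (1 : ℝ) ≤ n := by exact_mod_cast (by lia : 1 ≤ n)
  have h := hK n hn1
  rw [MellinBarnes.neg_four_div_factorial_mul_I hn, Finset.mul_sum]
  simp_rw [← MellinBarnes.two_mul_expansion_term_add_conj (n := (n : ℝ)) (by linarith)]
  rw [← Finset.mul_sum, Finset.sum_add_distrib, ← map_sum, ← Finset.mul_sum]
  set S := MellinBarnes.saddleIntegral n
  set M := Complex.exp (-(2 * MellinBarnes.saddleArg n)) * Real.sqrt Real.pi *
      ∑ l ∈ Finset.range (L + 1), BettinConrey.Ctilde l *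
        (Complex.exp ((Real.log (2 * Real.pi) / 2 + Real.pi / 4 * Complex.I) * (1 / 2 - l)) *
          (((n : ℝ) ^ (-(l : ℝ) / 2 - 3 / 4) : ℝ) : ℂ))
  have e : 2 * (S + (starRingEnd ℂ) S) - 2 * (M + (starRingEnd ℂ) M) =
      2 * ((S - M) + (starRingEnd ℂ) (S - M)) := by
    rw [map_sub]; ring
  have hpos : 0 ≤ (n : ℝ) ^ (-(L : ℝ) / 2 - 5 / 4) * Real.exp (-2 * Real.sqrt (Real.pi * n)) := by
    positivity
  rw [e, norm_mul, Real.norm_of_nonneg hpos]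
  have h2 : ‖(S - M) + (starRingEnd ℂ) (S - M)‖ ≤ ‖S - M‖ + ‖S - M‖ := by
    refine (norm_add_le _ _).trans ?_
    rw [Complex.norm_conj]
  have h3 : ‖(2 : ℂ)‖ = 2 := by norm_num
  rw [h3]
  linarith
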